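/- Let $p\equiv 3 \pmod 4$ be a prime, let $e,l,m$ be positive integers with $e=2m$, put $q=p^e$ and $s=\gcd(l,e)$, and assume that $e/s$ is even. Let $\mathrm{Tr}$ denote the absolute trace from $\mathbb{F}_q$ to $\mathbb{F}_p$, let $C_0\subset\mathbb{F}_p^*$ be the set of nonzero squares and $C_1\subset\mathbb{F}_p^*$ the set of non-squares. For $i\in\{0,1\}$ let $$D_i=\{(x_1,x_2)\in\mathbb{F}_q^2 : \mathrm{Tr}(x_1^{p^l+1})=1,\ \mathrm{Tr}(x_2)\in C_i\},$$ $$\mathcal{C}_{D_i}=\{(\mathrm{Tr}(ax_1+bx_2))_{(x_1,x_2)\in D_i} : a,b\in\mathbb{F}_q\}.$$ Suppose that $m\ge s+1$ and that $m/s$ is even. Then, for $i=0,1$, the linear code $\mathcal{C}_{D_i}$ over $\mathbb{F}_p$ has length $\frac{p-1}{2}(p^{2e-2}+p^{e+m+s-2})$ and dimension $2e$, and its weight distribution is given by the following table, where the multiplicities of rows with equal weights are to be added: | Weight | Multiplicity | |---|---| | $0$ | $1$ | | $\frac{p-1}{2}(p^{2e-2}+p^{e+m+s-2})$ | $p-1$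 | | $\frac{(p-1)^2}{2}(p^{2e-3}+p^{e+m+s-3})$ | $p^e(p^e-p^{1-2s})$ | | $\frac{(p-1)^2}{2}p^{2e-3}$ | $(p^{e-2s}+p^{e-2s-1}-p^{m-s}+p^{m-s-1}-2)/2$ | | $\frac{(p-1)^2}{2}p^{2e-3}+(p-1)p^{e+m+s-2}$ | $(p^{e-2s}-p^{e-2s-1}+p^{m-s}-p^{m-s-1})/2$ | | $\frac{(p-1)^2}{2}p^{2e-3}+\frac{p-1}{2}p^{e+m+s-2}$ | $(p-1)(p^{e-2s}+p^{e-2s-1}-p^{m-s}+p^{m-s-1}-2)/2$ | | $\frac{(p-1)^2}{2}p^{2e-3}+\frac{p-3}{2}p^{e+m+s-2}$ | $(p-1)(p^{e-2s}-p^{e-2s-1}+p^{m-s}-p^{m-s-1})/2$ | In particular $\mathcal{C}_{D_i}$ has at most six nonzero weights. If $m=s+1$, then $\frac{p-1}{2}(p^{2e-2}+p^{e+m+s-2})=\frac{(p-1)^2}{2}p^{2e-3}+(p-1)p^{e+m+s-2}$, and $\mathcal{C}_{D_i}$ has at most five nonzero weights. -/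

import Mathlib

namespace WeightDist

/-- The cyclotomic classes of order two in the prime field: `C₀` is the set of nonzero squares,
`C₁` is the set of nonsquares. -/
def cyclotomicClass (p : ℕ) (i : Fin 2) : Set (ZMod p) :=
  if i = 0 then {c | c ≠ 0 ∧ IsSquare c} else {c | c ≠ 0 ∧ ¬ IsSquare c}

open Classical in
/-- The defining set
`D_i = {(x₁, x₂) ∈ F² : Tr (x₁ ^ (p ^ l + 1)) = 1 and Tr x₂ ∈ C_i}`,
with `Tr` the absolute trace from `F` to the prime field. -/
noncomputable def definingSet (p : ℕ) (F : Type*) [Field F] [Fintype F] [Algebra (ZMod p) F]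
    (l : ℕ) (i : Fin 2) : Finset (F × F) :=
  Finset.univ.filter fun x =>
    Algebra.trace (ZMod p) F (x.1 ^ (p ^ l + 1)) = 1 ∧
      Algebra.trace (ZMod p) F x.2 ∈ cyclotomicClass p i

/-- The linear map sending `(a, b)` to the word `(Tr (a x₁ + b x₂))_{(x₁, x₂) ∈ D}`. -/
noncomputable def codewordMap (p : ℕ) (F : Type*) [Field F] [Algebra (ZMod p) F]
    (D : Finset (F × F)) : F × F →ₗ[ZMod p] (D → ZMod p) where
  toFun ab := fun x => Algebra.trace (ZMod p) F (ab.1 * x.1.1 + ab.2 * x.1.2)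
  map_add' u v := by
    funext x
    simp only [Prod.fst_add, Prod.snd_add, Pi.add_apply, ← map_add]
    congr 1
    ring
  map_smul' c u := by
    funext x
    simp [Prod.smul_fst, Prod.smul_snd, mul_add]

/-- The linear code `C_D = {(Tr (a x₁ + b x₂))_{(x₁, x₂) ∈ D} : a, b ∈ F}`; its coordinates are
indexed by `D`, so its length is the number of elements of `D`. -/
noncomputable def code (p : ℕ) (F : Type*) [Field F] [Algebra (ZMod p) F]
    (D : Finset (F × F)) : Submodule (ZMod p) (D → ZMod p) :=
  LinearMap.range (codewordMap p F D)

/-- `A_w`: the number of codewords of Hamming weight `w` in a code. -/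
noncomputable def weightCount {ι K : Type*} [Fintype ι] [Field K] [DecidableEq K]
    (C : Submodule K (ι → K)) (w : ℕ) : ℕ :=
  Set.ncard {c : ι → K | c ∈ C ∧ hammingNorm c = w}

/-- The number of distinct nonzero weights of a code: `|{1 ≤ w ≤ n : A_w ≠ 0}|`, where `n` is the
length. -/
noncomputable def numWeights {ι K : Type*} [Fintype ι] [Field K] [DecidableEq K]
    (C : Submodule K (ι → K)) : ℕ :=
  ((Finset.Icc 1 (Fintype.card ι)).filter fun w => weightCount C w ≠ 0).card

/-- The weights in the seven rows of the table. -/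
def tableWeight (p e m s : ℕ) : Fin 7 → ℚ :=
  ![0,
    ((p : ℚ) - 1) / 2 * ((p : ℚ) ^ (2 * e - 2) + (p : ℚ) ^ (e + m + s - 2)),
    ((p : ℚ) - 1) ^ 2 / 2 * ((p : ℚ) ^ (2 * e - 3) + (p : ℚ) ^ (e + m + s - 3)),
    ((p : ℚ) - 1) ^ 2 / 2 * (p : ℚ) ^ (2 * e - 3),
    ((p : ℚ) - 1) ^ 2 / 2 * (p : ℚ) ^ (2 * e - 3) + ((p : ℚ) - 1) * (p : ℚ) ^ (e + m + s - 2),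
    ((p : ℚ) - 1) ^ 2 / 2 * (p : ℚ) ^ (2 * e - 3)
      + ((p : ℚ) - 1) / 2 * (p : ℚ) ^ (e + m + s - 2),
    ((p : ℚ) - 1) ^ 2 / 2 * (p : ℚ) ^ (2 * e - 3)
      + ((p : ℚ) - 3) / 2 * (p : ℚ) ^ (e + m + s - 2)]

/-- The multiplicities in the seven rows of the table. (When `s ≥ 1`, `m ≥ s + 1` and `e = 2 m`,
no subtraction of natural numbers in an exponent truncates; the exponent `1 - 2 s`, which is
negative, is an integer.) -/
def tableMult (p e m s : ℕ) : Fin 7 → ℚ :=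
  ![1,
    (p : ℚ) - 1,
    (p : ℚ) ^ e * ((p : ℚ) ^ e - (p : ℚ) ^ (1 - 2 * (s : ℤ))),
    ((p : ℚ) ^ (e - 2 * s) + (p : ℚ) ^ (e - 2 * s - 1)
      - (p : ℚ) ^ (m - s) + (p : ℚ) ^ (m - s - 1) - 2) / 2,
    ((p : ℚ) ^ (e - 2 * s) - (p : ℚ) ^ (e - 2 * s - 1)
      + (p : ℚ) ^ (m - s) - (p : ℚ) ^ (m - s - 1)) / 2,
    ((p : ℚ) - 1) * ((p : ℚ) ^ (e - 2 * s) + (p : ℚ) ^ (e - 2 * s - 1)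
      - (p : ℚ) ^ (m - s) + (p : ℚ) ^ (m - s - 1) - 2) / 2,
    ((p : ℚ) - 1) * ((p : ℚ) ^ (e - 2 * s) - (p : ℚ) ^ (e - 2 * s - 1)
      + (p : ℚ) ^ (m - s) - (p : ℚ) ^ (m - s - 1)) / 2]

end WeightDist

namespace WeightDist

/-! Write `Q x = Tr (x * σ x)` with `σ` the `l`-th power of Frobenius, so that the first condition
on `D_i` is `Q x₁ = 1`. The weight of the word of `(a, b)` is the length minus its number of zeros,
so everything reduces to counting solutions; no character sums over `F` are needed.

The hypotheses give `l = s r`, `e = 4 s k`, `m = 2 s k` with `r` odd and coprime to `k`. The polar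
form of `Q` is `Tr (A c * x)` with `A = σ + σ⁻¹`, and its radical `ker A` is the solution set of `z
^ p ^ (2 l) = -z`, of size `p ^ (2 s)`. Scaling shows that `Q` takes every nonzero value equally
often, say `N` times. The second moment of the value distribution then gives `(p N - q) ^ 2 = q p ^
(2 s)` (`solCount_sq_eq`), and divisibility of `N` by `p ^ s + 1` selects `p N = q + p ^ (m + s)`
(`card_mul_solCount_twistedTraceForm`).

If `b` is not in the prime field or `a` is not in the image of `A`, some translation preserves `D_i`
and moves the coordinate at a nonzero rate, so exactly one `p`-th of the coordinates vanish.
Otherwise `a = A c` and `b` is a scalar. Since `-1` is a nonsquare, `C_i` contains one element of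
each pair `±t`, which reduces the count to the number of `x` with `Q x = 1` and `Tr (a x) = 0`
(`two_mul_zeroCount_algebraMap`). For `a ≠ 0` this depends only on whether `Q c` is a square, zero
included (`card_sq_mul_sectionCount`). It is found by splitting off the line of `c` when `Q c ≠ 0`,
and by translating along `c` when `Q c = 0`.

The rows of the table are these cases. Their sizes follow from `radCard` and `N`, and positivity of
the weights outside the zero row makes the encoding map injective, which gives the dimension and
turns pairs into codewords. -/

/-- The number of solutions of a predicate on a finite type. -/
noncomputable def solCount {α : Type*} (P : α → Prop) : ℕ := Nat.card {x // P x}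

/-! ### Elementary counting of solutions -/

section Counting

variable {α β : Type*}

theorem solCount_congr {P R : α → Prop} (h : ∀ x, P x ↔ R x) : solCount P = solCount R := by
  have : P = R := funext fun x => propext (h x)
  rw [this]

theorem solCount_equiv {P : α → Prop} {R : β → Prop} (e : α ≃ β) (h : ∀ x, P x ↔ R (e x)) :
    solCount P = solCount R :=
  Nat.card_congr (e.subtypeEquiv h)

theorem solCount_eq_card_filter [Fintype α] (P : α → Prop) [DecidablePred P] :
    solCount P = (Finset.univ.filter P).card := by
  rw [solCount, Nat.card_eq_fintype_card, Fintype.card_subtype]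

theorem solCount_true (α : Type*) [Fintype α] : solCount (fun _ : α => True) = Fintype.card α := by
  classical
  simp [solCount_eq_card_filter]

theorem solCount_false {P : α → Prop} (h : ∀ x, ¬ P x) : solCount P = 0 := by
  have : IsEmpty {x // P x} := ⟨fun x => h x.1 x.2⟩
  simp [solCount]

theorem solCount_eq_one (a : α) : solCount (fun x => x = a) = 1 := by
  simp [solCount]

theorem solCount_fiberwise [Fintype α] [Fintype β] (P : α → Prop) (f : α → β) :
    solCount P = ∑ u, solCount fun x => P x ∧ f x = u := by
  classical
  simp only [solCount_eq_card_filter]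
  rw [Finset.card_eq_sum_card_fiberwise (f := f) (t := Finset.univ) (by simp)]
  simp only [Finset.filter_filter]

theorem solCount_add_not [Fintype α] (P R : α → Prop) :
    solCount (fun x => P x ∧ R x) + solCount (fun x => P x ∧ ¬ R x) = solCount P := by
  classical
  simp only [solCount_eq_card_filter, ← Finset.filter_filter]
  exact Finset.card_filter_add_card_filter_not _

theorem solCount_prod [Fintype α] [Fintype β] (P : α × β → Prop) :
    solCount P = ∑ x, solCount fun y => P (x, y) := by
  classical
  rw [solCount_fiberwise P Prod.fst]
  refine Finset.sum_congr rfl fun u _ => ?_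
  refine Nat.card_congr
    { toFun := fun x => ⟨x.1.2, ?_⟩
      invFun := fun y => ⟨(u, y.1), y.2, rfl⟩
      left_inv := ?_
      right_inv := fun _ => rfl }
  · obtain ⟨⟨a, b⟩, h, rfl⟩ := x
    exact h
  · rintro ⟨⟨a, b⟩, h, rfl⟩
    rfl

theorem solCount_prod_and [Fintype α] [Fintype β] (P : α → Prop) (R : β → Prop) :
    solCount (fun x : α × β => P x.1 ∧ R x.2) = solCount P * solCount R := by
  classical
  simp only [solCount_eq_card_filter, ← Finset.card_product]
  congr 1
  ext x
  simp

end Counting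

/-! ### Equidistribution by translation -/

section Shift

variable {K V : Type*} [Field K] [Fintype K] [AddCommGroup V] [Module K V] [Fintype V]

/-- If translation by a vector `z` preserves `P` and shifts the value of `f` at a nonzero rate,
then `f` is equidistributed on `P`. -/
theorem solCount_shift (P : V → Prop) (f : V → K) (z : V) {k : K} (hk : k ≠ 0)
    (hP : ∀ x (t : K), P x → P (x + t • z))
    (hf : ∀ x (t : K), P x → f (x + t • z) = f x + t * k) (u : K) :
    (solCount fun x => P x ∧ f x = u) * Fintype.card K = solCount P := by
  rw [solCount_fiberwise P f, Finset.sum_eq_card_nsmul (b := solCount fun x => P x ∧ f x = u),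
    Finset.card_univ, smul_eq_mul, mul_comm]
  intro v _
  -- Translation by this multiple of `z` carries the fibre over `v` onto the fibre over `u`.
  refine solCount_equiv (Equiv.addRight (((u - v) / k) • z)) fun x => ?_
  simp only [Equiv.coe_addRight]
  constructor
  · rintro ⟨h, rfl⟩
    refine ⟨hP _ _ h, ?_⟩
    rw [hf _ _ h, div_mul_cancel₀ _ hk, add_sub_cancel]
  · rintro ⟨h, h2⟩
    have hx : P x := by simpa using hP _ (-((u - v) / k)) h
    refine ⟨hx, ?_⟩
    rw [hf _ _ hx, div_mul_cancel₀ _ hk] at h2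
    linear_combination h2

theorem solCount_linear (f : V →ₗ[K] K) (hf : f ≠ 0) (u : K) :
    (solCount fun x => f x = u) * Fintype.card K = Fintype.card V := by
  obtain ⟨z, hz⟩ : ∃ z, f z ≠ 0 := by
    by_contra! h
    exact hf (LinearMap.ext h)
  have := solCount_shift (fun _ : V => True) f z hz (by simp) (by simp) u
  simpa [solCount_true] using this

end Shift

/-! ### Second moment of the values of a quadratic form -/

section Quadratic

open QuadraticMap

variable {K V : Type*} [Field K] [Fintype K] [AddCommGroup V] [Module K V] [Fintype V]
  (Q : QuadraticForm K V)

/-- The number of vectors in the radical of the polar form. -/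
noncomputable def radCard : ℕ := solCount fun z => ∀ y, polar Q z y = 0

theorem map_eq_zero_of_polar_eq_zero {K V : Type*} [Field K] [AddCommGroup V] [Module K V]
    (Q : QuadraticForm K V) (h2 : (2 : K) ≠ 0) {z : V} (hz : ∀ y, polar Q z y = 0) :
    Q z = 0 := by
  have := hz z
  rw [polar_self, nsmul_eq_mul] at this
  simpa [h2] using this

/-- The sum of squares counts pairs with `Q x = Q y`. Replacing `x` by `z + y` turns this into `Q z
+ polar Q z y = 0`, an affine equation in `y`: it always holds for `z` in the radical, where `Q z =
0`, and otherwise it has `|V| / |K|` solutions. -/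
theorem sum_solCount_sq (h2 : (2 : K) ≠ 0) :
    Fintype.card K * ∑ v, (solCount fun x => Q x = v) ^ 2 + Fintype.card V * radCard Q =
      Fintype.card V * (Fintype.card V + radCard Q * Fintype.card K) := by
  classical
  have e1 : ∑ v, (solCount fun x => Q x = v) ^ 2
      = solCount fun x : V × V => Q x.1 = Q x.2 := by
    rw [solCount_fiberwise _ (fun x : V × V => Q x.1)]
    refine Finset.sum_congr rfl fun v _ => ?_
    rw [pow_two, ← solCount_prod_and]
    refine solCount_congr fun x => ?_
    constructor
    · rintro ⟨a, b⟩
      exact ⟨a.trans b.symm, a⟩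
    · rintro ⟨a, b⟩
      exact ⟨b, a ▸ b⟩
  have e2 : (solCount fun x : V × V => Q x.1 = Q x.2)
      = solCount fun x : V × V => Q x.1 + polar Q x.1 x.2 = 0 := by
    refine (solCount_equiv
      { toFun := fun x => (x.1 + x.2, x.2)
        invFun := fun x => (x.1 - x.2, x.2)
        left_inv := fun x => by simp
        right_inv := fun x => by simp } fun x => ?_).symm
    simp only [Equiv.coe_fn_mk, QuadraticMap.map_add]
    constructor
    · intro h
      linear_combination h
    · intro h
      linear_combination h
  have e3 : ∀ z, Fintype.card K * (solCount fun y => Q z + polar Q z y = 0)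
        + (if ∀ y, polar Q z y = 0 then Fintype.card V else 0)
      = Fintype.card V + if ∀ y, polar Q z y = 0 then Fintype.card V * Fintype.card K else 0 := by
    intro z
    split_ifs with hz
    · have : (solCount fun y => Q z + polar Q z y = 0) = Fintype.card V := by
        rw [← solCount_true]
        refine solCount_congr fun y => ?_
        simp [hz y, map_eq_zero_of_polar_eq_zero Q h2 hz]
      rw [this]
      ring
    · have := solCount_linear (polarBilin Q z) (fun h => hz fun y => by
        have := LinearMap.congr_fun h y
        simpa using this) (-Q z)
      rw [← this, add_zero, add_zero, mul_comm]
      congr 1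
      refine solCount_congr fun y => ?_
      rw [polarBilin_apply_apply]
      constructor
      · intro h
        linear_combination h
      · intro h
        linear_combination h
  rw [e1, e2, solCount_prod, Finset.mul_sum]
  have e4 := Finset.sum_congr (rfl : (Finset.univ : Finset V) = _) fun z _ => e3 z
  rw [Finset.sum_add_distrib, Finset.sum_add_distrib, ← Finset.sum_filter, ← Finset.sum_filter,
    Finset.sum_const, Finset.sum_const, Finset.sum_const, ← solCount_eq_card_filter,
    Finset.card_univ] at e4
  simp only [smul_eq_mul] at e4
  rw [radCard]
  linarith [e4]

/-- If a quadratic form takes all nonzero values equally often, the common frequency is determined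
up to a sign by the size of the radical. -/
theorem solCount_sq_eq (h2 : (2 : K) ≠ 0) {N : ℕ} (hN : ∀ v ≠ 0, (solCount fun x => Q x = v) = N) :
    ((Fintype.card K : ℤ) * N - Fintype.card V) ^ 2 = Fintype.card V * radCard Q := by
  classical
  have h1 := sum_solCount_sq Q h2
  have h0 := solCount_fiberwise (fun _ : V => True) Q
  simp only [true_and, solCount_true] at h0
  have hk : (1 : ℤ) < Fintype.card K := by exact_mod_cast Fintype.one_lt_card
  have hc : ((Finset.univ.erase (0 : K)).card : ℤ) = Fintype.card K - 1 := by
    rw [Finset.card_erase_of_mem (Finset.mem_univ _), Finset.card_univ,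
      Nat.cast_sub Fintype.card_pos]
    simp
  rw [← Finset.add_sum_erase _ _ (Finset.mem_univ (0 : K)),
    Finset.sum_congr rfl fun v hv => by rw [hN v (Finset.ne_of_mem_erase hv)],
    Finset.sum_const, smul_eq_mul] at h0 h1
  zify at h0 h1
  rw [hc] at h0 h1
  generalize (Fintype.card K : ℤ) = k at *
  generalize (Fintype.card V : ℤ) = n at *
  generalize (radCard Q : ℤ) = R at *
  have h3 : ((solCount fun x => Q x = 0 : ℕ) : ℤ) = n - (k - 1) * N := by linear_combination -h0
  rw [h3] at h1
  have hk' : k - 1 ≠ 0 := by omega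
  apply mul_left_cancel₀ hk'
  linear_combination h1

end Quadratic

/-! ### Frequencies on the hyperplane orthogonal to a nonisotropic vector -/

section OddRank

open QuadraticMap

variable {K V : Type*} [Field K] [Fintype K] [DecidableEq K] [AddCommGroup V] [Module K V]
  [Fintype V] (Q : QuadraticForm K V)

/-- Grouping by `u = t ^ 2`, which has `1 + χ u` roots, turns the sum into the Jacobi sum of `χ`
with itself, and `χ` is its own inverse. -/
theorem sum_quadraticChar_one_sub_sq (h2 : ringChar K ≠ 2) :
    ∑ t : K, quadraticChar K (1 - t ^ 2) = -quadraticChar K (-1) := by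
  have h := jacobiSum_nontrivial_inv (quadraticChar_ne_one h2)
  rw [(quadraticChar_isQuadratic K).inv, jacobiSum] at h
  have e1 : ∑ t : K, quadraticChar K (1 - t ^ 2)
      = ∑ u : K, (quadraticChar K u + 1) * quadraticChar K (1 - u) := by
    rw [← Finset.sum_fiberwise_of_maps_to (g := fun t : K => t ^ 2) (t := Finset.univ) (by simp)]
    refine Finset.sum_congr rfl fun u _ => ?_
    rw [← quadraticChar_card_sqrts h2,
      Finset.sum_congr rfl (g := fun _ => quadraticChar K (1 - u))
        (fun t ht => by rw [(Finset.mem_filter.1 ht).2]), Finset.sum_const, nsmul_eq_mul]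
    congr 2
    congr 1
    ext
    simp
  have e2 : ∑ u : K, quadraticChar K (1 - u) = 0 := by
    rw [← quadraticChar_sum_zero h2]
    exact Fintype.sum_equiv (Equiv.subLeft 1) _ _ fun _ => rfl
  rw [e1, ← h]
  simp only [add_mul, one_mul, Finset.sum_add_distrib, e2, add_zero]

theorem sum_quadraticChar_sq (h2 : ringChar K ≠ 2) :
    ∑ t : K, quadraticChar K (1 - t ^ 2) ^ 2 = Fintype.card K - 2 := by
  have h2' : (2 : K) ≠ 0 := Ring.two_ne_zero h2
  have : ∀ t : K, quadraticChar K (1 - t ^ 2) ^ 2 = 1 - if t ∈ ({1, -1} : Finset K) then 1 else 0 := by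
    intro t
    split_ifs with h
    · have : 1 - t ^ 2 = 0 := by
        rcases Finset.mem_insert.1 h with rfl | h
        · ring
        · rw [Finset.mem_singleton.1 h]
          ring
      simp [this]
    · rw [quadraticChar_sq_one, sub_zero]
      intro h0
      apply h
      have : (t - 1) * (t + 1) = 0 := by linear_combination -h0
      rcases mul_eq_zero.1 this with h | h
      · simp [sub_eq_zero.1 h]
      · simp [eq_neg_of_add_eq_zero_left h]
  have h3 : (1 : K) ≠ -1 := fun h => h2' (by linear_combination h)
  rw [Finset.sum_congr rfl fun t _ => this t, Finset.sum_sub_distrib, Finset.sum_ite_mem,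
    Finset.univ_inter, Finset.sum_pair h3]
  simp

/-- The number of vectors orthogonal to `c` at which `Q` takes the value `v`. -/
noncomputable def orthCount {K V : Type*} [Field K] [AddCommGroup V] [Module K V]
    (Q : QuadraticForm K V) (c : V) (v : K) : ℕ :=
  solCount fun x => Q x = v ∧ polar Q c x = 0

theorem orthCount_sq_mul {K V : Type*} [Field K] [AddCommGroup V] [Module K V]
    (Q : QuadraticForm K V) (c : V) {s : K} (hs : s ≠ 0) (v : K) :
    orthCount Q c (s ^ 2 * v) = orthCount Q c v := by
  refine (solCount_equiv (LinearEquiv.smulOfNeZero K V s hs).toEquiv fun x => ?_).symm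
  simp [QuadraticMap.map_smul, polar_smul_right, hs, pow_two]

/-- The frequencies of `Q` on the hyperplane orthogonal to `c` depend only on the square class. -/
theorem two_mul_orthCount {K V : Type*} [Field K] [Fintype K] [DecidableEq K] [AddCommGroup V]
    [Module K V] (Q : QuadraticForm K V) (h1 : quadraticChar K (-1) = -1) (c : V) (g w : K) :
    (2 * orthCount Q c (g * w) : ℤ) = 2 * orthCount Q c 0 + quadraticChar K w ^ 2 *
      (orthCount Q c g + orthCount Q c (-g) - 2 * orthCount Q c 0) +
      quadraticChar K w * (orthCount Q c g - orthCount Q c (-g)) := by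
  rcases eq_or_ne w 0 with rfl | hw
  · simp
  rcases quadraticChar_dichotomy hw with h | h
  · obtain ⟨r, rfl⟩ := (quadraticChar_one_iff_isSquare hw).1 h
    have hr : r ≠ 0 := by
      rintro rfl
      simp at hw
    rw [h, show g * (r * r) = r ^ 2 * g by ring, orthCount_sq_mul Q c hr]
    ring
  · have h' : quadraticChar K (-w) = 1 := by
      rw [neg_eq_neg_one_mul, map_mul, h, h1]
      norm_num
    obtain ⟨r, hr⟩ := (quadraticChar_one_iff_isSquare (neg_ne_zero.2 hw)).1 h'
    have hr0 : r ≠ 0 := by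
      rintro rfl
      simp at hr
      exact hw hr
    rw [h, show g * w = r ^ 2 * (-g) by linear_combination (-g) * hr, orthCount_sq_mul Q c hr0]
    ring

/-- Every vector is uniquely `x + t • c` with `x` orthogonal to `c`, and `Q (x + t • c) = Q x + Q c
* t ^ 2`. The parameter is read off from `polar Q c (x + t • c) = 2 * Q c * t`. -/
theorem solCount_eq_sum_orthCount {K V : Type*} [Field K] [Fintype K] [AddCommGroup V] [Module K V]
    [Fintype V] (Q : QuadraticForm K V) (h2 : (2 : K) ≠ 0) {c : V} (hc : Q c ≠ 0) (v : K) :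
    (solCount fun x => Q x = v) = ∑ t : K, orthCount Q c (v - Q c * t ^ 2) := by
  rw [solCount_fiberwise _ (fun x => polar Q c x)]
  symm
  refine Fintype.sum_equiv (Equiv.mulLeft₀ (2 * Q c) (mul_ne_zero h2 hc)) _ _ fun t => ?_
  refine solCount_equiv (Equiv.addRight (t • c)) fun x => ?_
  simp only [Equiv.coe_addRight, QuadraticMap.map_add Q, QuadraticMap.map_smul, polar_smul_right,
    polar_add_right, polar_self, smul_eq_mul, nsmul_eq_mul, Equiv.mulLeft₀_apply, Nat.cast_ofNat,
    polar_comm Q x c]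
  constructor
  · rintro ⟨h, h'⟩
    rw [h, h']
    constructor <;> ring
  · rintro ⟨h, h'⟩
    have h3 : polar Q c x = 0 := by linear_combination h'
    rw [h3] at h
    refine ⟨?_, h3⟩
    linear_combination h

/-- On the hyperplane the frequencies are constant on square classes, and `Q c`, `-Q c` represent
both classes of nonzero elements. So there are three unknowns, the frequencies at `0`, `Q c` and `-Q
c`. Three linear equations determine them: the number of zeros of `Q`, the size of the hyperplane,
and the frequency of `Q c` on the whole space. -/
theorem orthCount_eq (h2 : ringChar K ≠ 2) (h1 : quadraticChar K (-1) = -1) {N : ℕ}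
    (hN : ∀ v ≠ 0, (solCount fun x => Q x = v) = N) {c : V} (hc : Q c ≠ 0) :
    (Fintype.card K : ℤ) ^ 2 * orthCount Q c (Q c) = Fintype.card V +
        Fintype.card K * (Fintype.card K * N - Fintype.card V) ∧
      (Fintype.card K : ℤ) ^ 2 * orthCount Q c (-Q c) = Fintype.card V -
        Fintype.card K * (Fintype.card K * N - Fintype.card V) := by
  have h2' : (2 : K) ≠ 0 := Ring.two_ne_zero h2
  have hk : (1 : ℤ) < Fintype.card K := by exact_mod_cast Fintype.one_lt_card
  have hce : ((Finset.univ.erase (0 : K)).card : ℤ) = Fintype.card K - 1 := by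
    rw [Finset.card_erase_of_mem (Finset.mem_univ _), Finset.card_univ,
      Nat.cast_sub Fintype.card_pos]
    simp
  have E0 : (Fintype.card V : ℤ) = (solCount fun x => Q x = 0 : ℕ) + (Fintype.card K - 1) * N := by
    have h0 := solCount_fiberwise (fun _ : V => True) Q
    simp only [true_and, solCount_true] at h0
    rw [← Finset.add_sum_erase _ _ (Finset.mem_univ (0 : K)),
      Finset.sum_congr rfl fun v hv => by rw [hN v (Finset.ne_of_mem_erase hv)],
      Finset.sum_const, smul_eq_mul] at h0
    zify at h0
    rw [h0, hce]
  have E1 : ((solCount fun x => Q x = 0 : ℕ) : ℤ) =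
      orthCount Q c 0 + (Fintype.card K - 1) * orthCount Q c (-Q c) := by
    rw [solCount_eq_sum_orthCount Q h2' hc, ← Finset.add_sum_erase _ _ (Finset.mem_univ (0 : K)),
      Finset.sum_congr rfl (g := fun _ => orthCount Q c (-Q c)), Finset.sum_const, smul_eq_mul]
    · push_cast
      rw [hce]
      simp
    · intro t ht
      rw [show 0 - Q c * t ^ 2 = t ^ 2 * (-Q c) by ring,
        orthCount_sq_mul Q c (Finset.ne_of_mem_erase ht)]
  have E2 : (Fintype.card K : ℤ) * (2 * orthCount Q c 0 + (Fintype.card K - 1) *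
      (orthCount Q c (Q c) + orthCount Q c (-Q c))) = 2 * Fintype.card V := by
    have hl := solCount_linear (polarBilin Q c) (fun h => by
      have := LinearMap.congr_fun h c
      rw [polarBilin_apply_apply, polar_self] at this
      simp [h2', hc] at this) 0
    have h3 : (solCount fun x => polarBilin Q c x = 0) = ∑ w, orthCount Q c (Q c * w) := by
      rw [solCount_fiberwise _ Q]
      symm
      refine Fintype.sum_equiv (Equiv.mulLeft₀ (Q c) hc) _ _ fun t => ?_
      refine solCount_congr fun x => ?_
      simp [and_comm]
    rw [h3] at hl
    have h4 : (2 : ℤ) * ∑ w, (orthCount Q c (Q c * w) : ℤ) = 2 * orthCount Q c 0 +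
        (Fintype.card K - 1) * (orthCount Q c (Q c) + orthCount Q c (-Q c)) := by
      rw [Finset.mul_sum, Finset.sum_congr rfl fun w _ => two_mul_orthCount Q h1 c _ w,
        Finset.sum_add_distrib, Finset.sum_add_distrib, ← Finset.sum_mul, ← Finset.sum_mul, ← Finset.sum_mul,
        quadraticChar_sum_zero h2]
      have : ∑ w : K, quadraticChar K w ^ 2 = (Fintype.card K : ℤ) - 1 := by
        rw [← Finset.add_sum_erase _ _ (Finset.mem_univ (0 : K)),
          Finset.sum_congr rfl fun w hw => quadraticChar_sq_one (Finset.ne_of_mem_erase hw),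
          Finset.sum_const, nsmul_eq_mul, hce]
        simp
      rw [this, Finset.sum_const, Finset.card_univ, nsmul_eq_mul]
      ring
    rw [← h4, ← hl]
    push_cast
    ring
  have E3 : (2 * N : ℤ) = 4 * orthCount Q c 0 + (Fintype.card K - 1) * orthCount Q c (Q c) +
      (Fintype.card K - 3) * orthCount Q c (-Q c) := by
    rw [← hN (Q c) hc, solCount_eq_sum_orthCount Q h2' hc]
    push_cast
    rw [Finset.mul_sum, Finset.sum_congr rfl fun t _ => by
      rw [show Q c - Q c * t ^ 2 = Q c * (1 - t ^ 2) by ring, two_mul_orthCount Q h1 c],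
      Finset.sum_add_distrib, Finset.sum_add_distrib, ← Finset.sum_mul, ← Finset.sum_mul, ← Finset.sum_mul,
      sum_quadraticChar_one_sub_sq h2, sum_quadraticChar_sq h2, h1, Finset.sum_const,
      Finset.card_univ, nsmul_eq_mul]
    ring
  rw [E1] at E0
  generalize (Fintype.card K : ℤ) = k at *
  generalize (Fintype.card V : ℤ) = n at *
  generalize (orthCount Q c (Q c) : ℤ) = a at *
  generalize (orthCount Q c (-Q c) : ℤ) = b at *
  generalize (orthCount Q c 0 : ℤ) = z at *
  -- The combination eliminates the frequencies at `0` and at `Q c`.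
  have hb : k ^ 2 * b = n - k * (k * N - n) := by
    have : 2 * (k ^ 2 * b) = 2 * (n - k * (k * N - n)) := by
      linear_combination E2 + k * E3 - 2 * k * E0
    omega
  refine ⟨?_, hb⟩
  have hk' : k - 1 ≠ 0 := by omega
  apply mul_left_cancel₀ hk'
  linear_combination k * E2 + 2 * k ^ 2 * E0 + (k - 1) * hb

end OddRank

/-! ### The form `Tr (x * σ x)`, its polar form and its radical -/

section TwistedTrace

open QuadraticMap

variable {K F : Type*} [Field K] [Field F] [Algebra K F] (σ : F ≃ₐ[K] F)

/-- The quadratic form `x ↦ Tr (x * σ x)`. -/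
noncomputable def twistedTraceForm : QuadraticForm K F :=
  LinearMap.BilinMap.toQuadraticMap ((Algebra.traceForm K F).compl₂ σ.toLinearMap)

theorem twistedTraceForm_apply (x : F) :
    twistedTraceForm σ x = Algebra.trace K F (x * σ x) := rfl

/-- The self-adjoint map representing the polar form of `twistedTraceForm σ` with respect to the
trace form. -/
noncomputable def twistedAdjoint : F →ₗ[K] F := σ.toLinearMap + σ.symm.toLinearMap

theorem twistedAdjoint_apply (x : F) : twistedAdjoint σ x = σ x + σ.symm x := rfl

/-- The trace is invariant under `σ`, so `σ` can be moved from `x` to `σ.symm` on `c`. -/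
theorem polar_twistedTraceForm (c x : F) :
    polar (twistedTraceForm σ) c x = Algebra.trace K F (twistedAdjoint σ c * x) := by
  have h : Algebra.trace K F (c * σ x) = Algebra.trace K F (σ.symm c * x) := by
    rw [← Algebra.trace_eq_of_algEquiv σ (σ.symm c * x)]
    simp
  simp only [polar, twistedTraceForm_apply, twistedAdjoint_apply, map_add, add_mul, mul_add, h,
    mul_comm x (σ c)]
  ring

variable [FiniteDimensional K F] [Algebra.IsSeparable K F]

theorem eq_zero_of_forall_trace_mul {a : F} (h : ∀ x, Algebra.trace K F (a * x) = 0) : a = 0 :=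
  (traceForm_nondegenerate K F).1 a h

theorem polar_twistedTraceForm_eq_zero_iff (c : F) :
    (∀ x, polar (twistedTraceForm σ) c x = 0) ↔ twistedAdjoint σ c = 0 := by
  simp only [polar_twistedTraceForm]
  exact ⟨eq_zero_of_forall_trace_mul, fun h x => by simp [h]⟩

/-- An element outside a subspace is detected by the trace against an element orthogonal to that
subspace. -/
theorem exists_trace_mul_ne_zero (W : Submodule K F) {a : F} (ha : a ∉ W) :
    ∃ z, (∀ w ∈ W, Algebra.trace K F (z * w) = 0) ∧ Algebra.trace K F (z * a) ≠ 0 := by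
  obtain ⟨f, hf, hW⟩ := Submodule.exists_le_ker_of_notMem ha
  obtain ⟨z, rfl⟩ := ((Algebra.traceForm K F).toDual (traceForm_nondegenerate K F)).surjective f
  exact ⟨z, fun w hw => hW hw, hf⟩

/-- The map is self-adjoint for the trace form, so the orthogonal complement of its range is its
kernel. -/
theorem exists_mem_ker_twistedAdjoint {a : F} (ha : a ∉ LinearMap.range (twistedAdjoint σ)) :
    ∃ z, twistedAdjoint σ z = 0 ∧ Algebra.trace K F (a * z) ≠ 0 := by
  obtain ⟨z, hz, hza⟩ := exists_trace_mul_ne_zero _ ha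
  refine ⟨z, (polar_twistedTraceForm_eq_zero_iff σ z).1 fun x => ?_, by rwa [mul_comm]⟩
  rw [polar_comm, polar_twistedTraceForm, mul_comm]
  exact hz _ ⟨x, rfl⟩

end TwistedTrace

/-! ### Roots in cyclic groups and finite fields -/

section Roots

/-- For a generator `g` and `v = g ^ i`, the group order divides `i * a`; hence so does `a * b`, and
`b` divides `i`. -/
theorem exists_pow_eq_of_pow_eq_one {G : Type*} [Group G] [IsCyclic G] [Finite G] {v : G}
    {a b : ℕ} (ha : a ≠ 0) (hv : v ^ a = 1) (hab : a * b ∣ Nat.card G) : ∃ x : G, x ^ b = v := by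
  obtain ⟨g, hg⟩ := IsCyclic.exists_monoid_generator (α := G)
  obtain ⟨i, rfl⟩ := hg v
  have hord : orderOf g = Nat.card G :=
    orderOf_eq_card_of_forall_mem_zpowers fun x => by
      obtain ⟨j, rfl⟩ := hg x
      exact ⟨j, by simp⟩
  simp only [← pow_mul] at hv
  have h := hab.trans (hord ▸ orderOf_dvd_of_pow_eq_one hv)
  rw [mul_comm i] at h
  obtain ⟨j, rfl⟩ := Nat.dvd_of_mul_dvd_mul_left (Nat.pos_of_ne_zero ha) h
  exact ⟨g ^ j, by simp only [← pow_mul, mul_comm b]⟩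

variable {F : Type*} [Field F] [Fintype F]

theorem exists_pow_eq {v : F} {a b : ℕ} (ha : a ≠ 0) (hv : v ^ a = 1)
    (hab : a * b ∣ Fintype.card F - 1) : ∃ x : F, x ≠ 0 ∧ x ^ b = v := by
  have hv0 : v ≠ 0 := by
    rintro rfl
    simp [ha] at hv
  obtain ⟨x, hx⟩ := exists_pow_eq_of_pow_eq_one (v := Units.mk0 v hv0) (a := a) (b := b) ha
    (by ext; simpa using hv) (by rwa [Nat.card_units, Nat.card_eq_fintype_card])
  exact ⟨x, x.ne_zero, by simpa using congrArg Units.val hx⟩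

theorem solCount_pow_eq_one {d : ℕ} (hd : d ≠ 0) :
    (solCount fun x : F => x ^ d = 1) = (Fintype.card F - 1).gcd d := by
  rw [← Nat.card_eq_fintype_card, ← Nat.card_units, ← IsCyclic.card_powMonoidHom_ker]
  refine Nat.card_congr
    { toFun := fun x => ⟨Units.mk0 x.1 (fun h => by simpa [h, hd] using x.2), ?_⟩
      invFun := fun u => ⟨u.1, ?_⟩
      left_inv := fun _ => rfl
      right_inv := fun _ => by ext; rfl }
  · rw [MonoidHom.mem_ker]
    ext
    simpa using x.2
  · have := u.2
    rw [MonoidHom.mem_ker] at this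
    simpa using congrArg Units.val this

end Roots

/-! ### Fixed and anti-fixed points of powers of Frobenius -/

section Frobenius

variable {F : Type*} [Field F]

theorem pow_pow_eq_of_pow_eq {x : F} {P : ℕ} (h : x ^ P = x) (j : ℕ) : x ^ P ^ j = x := by
  induction j with
  | zero => simp
  | succ j ih => rw [pow_succ, pow_mul, ih, h]

theorem pow_pow_eq_of_pow_eq_neg {x : F} {P : ℕ} (hP : Odd P) (h : x ^ P = -x) (j : ℕ) :
    x ^ P ^ j = (-1) ^ j * x := by
  induction j with
  | zero => simp
  | succ j ih =>
    rw [pow_succ, pow_mul, ih, mul_pow, h, ← pow_mul, mul_comm j, pow_mul, hP.neg_one_pow]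
    ring

theorem gcd_pow_sub_one {p s k r : ℕ} (hr : Odd r) (hc : Nat.Coprime r k) :
    (p ^ (4 * s * k) - 1).gcd (p ^ (2 * (s * r)) - 1) = p ^ (2 * s) - 1 := by
  rw [Nat.pow_sub_one_gcd_pow_sub_one]
  congr 2
  rw [show 4 * s * k = 2 * s * (2 * k) by ring, show 2 * (s * r) = 2 * s * r by ring,
    Nat.gcd_mul_left, Nat.Coprime.gcd_eq_one, mul_one]
  exact Nat.Coprime.mul_left (Nat.coprime_two_left.2 hr) hc.symm

theorem two_mul_pow_sub_one_dvd {p : ℕ} (hp : Odd p) (s k : ℕ) :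
    2 * (p ^ (2 * s) - 1) ∣ p ^ (4 * s * k) - 1 := by
  have h1 : p ^ (4 * s) - 1 ∣ p ^ (4 * s * k) - 1 := by
    rw [pow_mul p (4 * s) k]
    exact Nat.sub_one_dvd_pow_sub_one _ _
  refine dvd_trans ?_ h1
  rw [show p ^ (4 * s) = (p ^ (2 * s)) ^ 2 by ring, ← one_pow 2, Nat.sq_sub_sq, one_pow]
  exact mul_dvd_mul_right (hp.pow.add_odd odd_one).two_dvd _

theorem sub_one_mul_pow_add_one_dvd (p s k : ℕ) :
    (p - 1) * (p ^ s + 1) ∣ p ^ (4 * s * k) - 1 := by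
  have h1 : p ^ (2 * s) - 1 ∣ p ^ (4 * s * k) - 1 := by
    rw [show 4 * s * k = 2 * s * (2 * k) by ring, pow_mul p (2 * s)]
    exact Nat.sub_one_dvd_pow_sub_one _ _
  refine dvd_trans ?_ h1
  rw [show p ^ (2 * s) = (p ^ s) ^ 2 by ring, ← one_pow 2, Nat.sq_sub_sq, one_pow, mul_comm]
  exact mul_dvd_mul_left _ (Nat.sub_one_dvd_pow_sub_one _ _)

variable [Fintype F] {p s k r : ℕ}

/-- The number of solutions of `z ^ (p ^ (2 s r)) = -z` in a field with `p ^ (4 s k)` elements. -/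
theorem solCount_pow_eq_neg (hp : Odd p) (hp1 : 1 < p) (hs : 0 < s)
    (hcard : Fintype.card F = p ^ (4 * s * k)) (hr : Odd r) (hc : Nat.Coprime r k) :
    (solCount fun z : F => z ^ p ^ (2 * (s * r)) = -z) = p ^ (2 * s) := by
  -- An `x` with `x ^ (p ^ (2 s) - 1) = -1` is itself a solution because `r` is odd. Multiplication
  -- by it matches the fixed points of `z ↦ z ^ p ^ (2 s r)` with the required solutions, and fixed
  -- points are counted by a gcd.
  obtain ⟨x, hx0, hx⟩ := exists_pow_eq (F := F) (v := -1) two_ne_zero (by simp)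
    (hcard ▸ two_mul_pow_sub_one_dvd hp s k)
  have hpos : 1 < p ^ (2 * s) := Nat.one_lt_pow (by omega) hp1
  have hr0 : r ≠ 0 := by
    rintro rfl
    simp at hr
  have hpos' : 1 < p ^ (2 * (s * r)) := Nat.one_lt_pow (by positivity) hp1
  have hx1 : x ^ p ^ (2 * s) = -x := by
    rw [← Nat.sub_add_cancel hpos.le, pow_succ, hx]
    ring
  have hx2 : x ^ p ^ (2 * (s * r)) = -x := by
    rw [show 2 * (s * r) = 2 * s * r by ring, pow_mul, pow_pow_eq_of_pow_eq_neg hp.pow hx1,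
      hr.neg_one_pow]
    ring
  have h1 : (solCount fun z : F => z ^ p ^ (2 * (s * r)) = -z)
      = solCount fun z : F => z ^ p ^ (2 * (s * r)) = z := by
    refine (solCount_equiv (Equiv.mulRight₀ x hx0) fun z => ?_).symm
    rw [Equiv.mulRight₀_apply, mul_pow, hx2, mul_neg, neg_inj]
    exact (mul_left_inj' hx0).symm
  have h2 : (solCount fun z : F => z ^ p ^ (2 * (s * r)) = z)
      = 1 + solCount fun z : F => z ^ (p ^ (2 * (s * r)) - 1) = 1 := by
    rw [← solCount_add_not _ (fun z : F => z = 0)]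
    congr 1
    · rw [← solCount_eq_one (0 : F)]
      refine solCount_congr fun z => ⟨fun h => h.2, ?_⟩
      rintro rfl
      exact ⟨zero_pow (by omega), rfl⟩
    · refine solCount_congr fun z => ?_
      constructor
      · rintro ⟨h, h0⟩
        apply mul_right_cancel₀ h0
        rw [← pow_succ, Nat.sub_add_cancel hpos'.le, h, one_mul]
      · intro h
        have h0 : z ≠ 0 := by
          rintro rfl
          rw [zero_pow (by omega)] at h
          exact zero_ne_one h
        refine ⟨?_, h0⟩
        rw [← Nat.sub_add_cancel hpos'.le, pow_succ, h, one_mul]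
  rw [h1, h2, solCount_pow_eq_one (by omega), hcard, gcd_pow_sub_one hr hc]
  omega

end Frobenius

/-! ### Frequencies of the nonzero values of the form -/

section Frequencies

open QuadraticMap

variable {K F : Type*} [Field K] [Fintype K] [Field F] [Fintype F] [Algebra K F] {σ : F ≃ₐ[K] F}
  {p s k r : ℕ}

theorem radCard_twistedTraceForm (hp : Odd p) (hp1 : 1 < p) (hs : 0 < s)
    (hσ : ∀ x, σ x = x ^ p ^ (s * r)) (hcard : Fintype.card F = p ^ (4 * s * k)) (hr : Odd r)
    (hc : Nat.Coprime r k) : radCard (twistedTraceForm σ) = p ^ (2 * s) := by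
  rw [← solCount_pow_eq_neg hp hp1 hs hcard hr hc]
  refine solCount_congr fun z => ?_
  rw [polar_twistedTraceForm_eq_zero_iff, twistedAdjoint_apply, ← σ.injective.eq_iff, map_add,
    map_zero, σ.apply_symm_apply, hσ, hσ, ← pow_mul, ← pow_add, ← two_mul]
  exact eq_neg_iff_add_eq_zero.symm

/-- A scalar `v ≠ 0` has a root `x ^ (p ^ s + 1) = v` in `F`. Such an `x` is fixed by `p ^ (2 s)`-th
powers, so `σ x = x ^ p ^ s` for odd `r` and `x * σ x = v`. Multiplication by `x` then multiplies
the form by `v`. -/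
theorem solCount_twistedTraceForm_eq (hK : Fintype.card K = p)
    (hσ : ∀ x, σ x = x ^ p ^ (s * r)) (hcard : Fintype.card F = p ^ (4 * s * k)) (hr : Odd r)
    {v : K} (hv : v ≠ 0) :
    (solCount fun x => twistedTraceForm σ x = v) = solCount fun x => twistedTraceForm σ x = 1 := by
  have hp1 : 1 < p := hK ▸ Fintype.one_lt_card
  have hv1 : v ^ (p - 1) = 1 := hK ▸ FiniteField.pow_card_sub_one_eq_one v hv
  obtain ⟨x, hx0, hx⟩ := exists_pow_eq (F := F) (v := algebraMap K F v) (a := p - 1)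
    (b := p ^ s + 1) (by omega) (by rw [← map_pow, hv1, map_one])
    (hcard ▸ sub_one_mul_pow_add_one_dvd p s k)
  have hx1 : x ^ (p ^ s) ^ 2 = x := by
    have h1 : x ^ ((p ^ s + 1) * (p ^ s - 1)) = 1 := by
      obtain ⟨j, hj⟩ := Nat.sub_one_dvd_pow_sub_one p s
      rw [pow_mul, hx, hj, pow_mul, ← map_pow, hv1, map_one, one_pow]
    rw [← Nat.sq_sub_sq, one_pow] at h1
    rw [← Nat.sub_add_cancel (Nat.one_le_pow 2 (p ^ s) (by positivity)), pow_succ, h1, one_mul]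
  have hx2 : x * σ x = algebraMap K F v := by
    obtain ⟨j, rfl⟩ := hr
    rw [hσ, ← hx, pow_succ, mul_comm, pow_mul p s, pow_succ, pow_mul (p ^ s), pow_mul x,
      pow_pow_eq_of_pow_eq hx1]
  refine (solCount_equiv (Equiv.mulLeft₀ x hx0) fun z => ?_).symm
  change _ ↔ twistedTraceForm σ (x * z) = v
  rw [twistedTraceForm_apply, twistedTraceForm_apply, map_mul σ,
    mul_mul_mul_comm, hx2, ← Algebra.smul_def, LinearMap.map_smul, smul_eq_mul]
  exact (mul_eq_left₀ hv).symm

/-- The `(p ^ s + 1)`-th roots of unity act freely by multiplication on the solutions: as `r` is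
odd, `p ^ s + 1` divides `p ^ (s r) + 1`, so `z * σ z = 1` for such a root `z`. The fibres of `x ↦ x
^ (p ^ s + 1)` are the orbits. -/
theorem dvd_solCount_twistedTraceForm {K F : Type*} [Field K] [Field F] [Fintype F] [Algebra K F]
    {σ : F ≃ₐ[K] F} {p s k r : ℕ}
    (hσ : ∀ x, σ x = x ^ p ^ (s * r)) (hcard : Fintype.card F = p ^ (4 * s * k)) (hr : Odd r) :
    p ^ s + 1 ∣ solCount fun x => twistedTraceForm σ x = 1 := by
  rw [solCount_fiberwise _ (fun x : F => x ^ (p ^ s + 1))]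
  refine Finset.dvd_sum fun w _ => ?_
  by_cases hw : ∃ x : F, twistedTraceForm σ x = 1 ∧ x ^ (p ^ s + 1) = w
  · obtain ⟨x, hx, rfl⟩ := hw
    have hx0 : x ≠ 0 := by
      rintro rfl
      simp at hx
    have hd : p ^ s + 1 ∣ Fintype.card F - 1 :=
      hcard ▸ (Dvd.intro_left _ rfl).trans (sub_one_mul_pow_add_one_dvd p s k)
    have h1 := solCount_pow_eq_one (F := F) (d := p ^ s + 1) (by omega)
    rw [Nat.gcd_eq_right hd] at h1
    refine (dvd_of_eq h1.symm).trans (dvd_of_eq ?_)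
    refine solCount_equiv (Equiv.mulRight₀ x hx0) fun z => ?_
    rw [Equiv.mulRight₀_apply, mul_pow, mul_eq_right₀ (pow_ne_zero _ hx0)]
    refine ⟨fun h => ⟨?_, h⟩, fun h => h.2⟩
    have hz : z * σ z = 1 := by
      have : p ^ s + 1 ∣ p ^ (s * r) + 1 := by
        simpa [pow_mul] using hr.nat_add_dvd_pow_add_pow (p ^ s) 1
      obtain ⟨j, hj⟩ := this
      rw [hσ, ← pow_succ', hj, pow_mul, h, one_pow]
    change twistedTraceForm σ (z * x) = 1
    rw [← hx, twistedTraceForm_apply, twistedTraceForm_apply, map_mul σ, mul_mul_mul_comm, hz,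
      one_mul]
  · rw [solCount_false fun x hx => hw ⟨x, hx⟩]
    exact dvd_zero _

/-- The form `x ↦ Tr (x ^ (p ^ (s r) + 1))` is elliptic modulo its radical: this is the frequency
of its nonzero values. -/
theorem card_mul_solCount_twistedTraceForm (hK : Fintype.card K = p) (hp : Odd p) (hs : 0 < s)
    (hσ : ∀ x, σ x = x ^ p ^ (s * r)) (hcard : Fintype.card F = p ^ (4 * s * k)) (hr : Odd r)
    (hc : Nat.Coprime r k) :
    p * (solCount fun x => twistedTraceForm σ x = 1) = p ^ (4 * s * k) + p ^ (2 * s * k + s) := by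
  have hp1 : 1 < p := hK ▸ Fintype.one_lt_card
  have h2 : (2 : K) ≠ 0 := by
    refine Ring.two_ne_zero fun h => ?_
    have := (FiniteField.even_card_iff_char_two (F := K)).1 h
    rw [hK] at this
    rw [Nat.odd_iff] at hp
    omega
  have h1 := solCount_sq_eq (twistedTraceForm σ) h2
    fun v hv => solCount_twistedTraceForm_eq hK hσ hcard hr hv
  rw [radCard_twistedTraceForm hp hp1 hs hσ hcard hr hc, hK, hcard] at h1
  obtain ⟨N, hN⟩ := dvd_solCount_twistedTraceForm hσ hcard hr
  rw [hN] at h1 ⊢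
  push_cast at h1
  rw [show (p : ℤ) ^ (4 * s * k) * p ^ (2 * s) = (p ^ (2 * s * k + s)) ^ 2 by ring] at h1
  zify
  rcases sq_eq_sq_iff_eq_or_eq_neg.1 h1 with h | h
  · linear_combination h
  -- With the other sign, reduction modulo `p ^ s + 1` uses `p ^ (4 s k) ≡ 1` and `p ^ (2 s k + s) ≡
  -- -1`. The count is divisible by `p ^ s + 1`, so `p ^ s + 1` would divide `2`.
  · exfalso
    have h3 : ((p ^ s + 1 : ℕ) : ℤ) ∣ p ^ (4 * s * k) - 1 := by
      have : p ^ s + 1 ∣ p ^ (4 * s * k) - 1 :=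
        (Dvd.intro_left _ rfl).trans (sub_one_mul_pow_add_one_dvd p s k)
      have h5 := Int.natCast_dvd_natCast.2 this
      rwa [Nat.cast_sub (Nat.one_le_pow _ _ (by omega)), Nat.cast_pow, Nat.cast_one] at h5
    have h4 : ((p ^ s + 1 : ℕ) : ℤ) ∣ p ^ (2 * s * k + s) + 1 := by
      have : p ^ s + 1 ∣ p ^ (s * (2 * k + 1)) + 1 := by
        simpa [pow_mul] using (odd_two_mul_add_one k).nat_add_dvd_pow_add_pow (p ^ s) 1
      rw [show s * (2 * k + 1) = 2 * s * k + s by ring] at this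
      exact_mod_cast this
    have h5 : ((p ^ s + 1 : ℕ) : ℤ) ∣ 2 := by
      have h6 := dvd_add (dvd_sub h4 h3) (Dvd.intro (p * N : ℤ) rfl)
      have h7 : (p : ℤ) ^ (2 * s * k + s) + 1 - (p ^ (4 * s * k) - 1) +
          ((p ^ s + 1 : ℕ) : ℤ) * (p * N) = 2 := by
        push_cast
        linear_combination h
      rwa [h7] at h6
    have h6 := Int.le_of_dvd two_pos h5
    have h7 : p ≤ p ^ s := Nat.le_self_pow hs.ne' p
    push_cast at h6
    zify at h7
    have h8 : p ≠ 2 := by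
      rintro rfl
      exact absurd hp (by decide)
    omega

end Frequencies

/-! ### Sums over one representative of each pair `±t` -/

section HalfSystem

variable {K : Type*} [Field K] [Fintype K] {C : K → Prop}

open Classical in
theorem two_mul_sum_half (h0 : ¬ C 0) (hC : ∀ t ≠ 0, (C (-t) ↔ ¬ C t)) (g : K → ℕ)
    (hg : ∀ t, g (-t) = g t) :
    2 * ∑ t, (if C t then g t else 0) + g 0 = ∑ t, g t := by
  have h1 : ∑ t, (if C t then g t else 0) = ∑ t, if C (-t) then g t else 0 :=
    Fintype.sum_equiv (Equiv.neg K) _ _ fun t => by simp [hg]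
  have h2 : ∀ t, (if C t then g t else 0) + (if C (-t) then g t else 0) + (if t = 0 then g 0 else 0)
      = g t := by
    intro t
    rcases eq_or_ne t 0 with rfl | ht
    · simp [h0]
    · by_cases h : C t <;> simp [hC t ht, h, ht]
  rw [← Finset.sum_congr rfl fun t _ => h2 t, Finset.sum_add_distrib, Finset.sum_add_distrib, ← h1]
  simp [two_mul]

end HalfSystem

/-! ### Zero coordinates of a word and hyperplane sections of `Q x = 1` -/

section ZeroCounts

open QuadraticMap

variable {K F : Type*} [Field K] [Fintype K] [Field F] [Fintype F] [Algebra K F] (σ : F ≃ₐ[K] F)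
  {C : K → Prop}

/-- Membership in the set `{(x₁, x₂) : Q x₁ = 1, Tr x₂ ∈ C}`. -/
def InDefiningSet (C : K → Prop) (x : F × F) : Prop :=
  twistedTraceForm σ x.1 = 1 ∧ C (Algebra.trace K F x.2)

/-- The number of zero coordinates of the word attached to `(a, b)`. -/
noncomputable def zeroCount (C : K → Prop) (a b : F) : ℕ :=
  solCount fun x : F × F => InDefiningSet σ C x ∧ Algebra.trace K F (a * x.1 + b * x.2) = 0

/-- The number of `x` with `Q x = 1` and `Tr (a x) = 0`. -/
noncomputable def sectionCount (a : F) : ℕ :=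
  solCount fun x => twistedTraceForm σ x = 1 ∧ Algebra.trace K F (a * x) = 0

theorem solCount_inDefiningSet {K F : Type*} [Field K] [Field F] [Fintype F] [Algebra K F]
    (σ : F ≃ₐ[K] F) (C : K → Prop) : solCount (InDefiningSet σ C) =
    (solCount fun x => twistedTraceForm σ x = 1) * solCount fun x => C (Algebra.trace K F x) :=
  solCount_prod_and (fun x => twistedTraceForm σ x = 1) fun x => C (Algebra.trace K F x)

/-- Some `z` has `Tr z = 0` and `Tr (z b) ≠ 0`; translating `x₂` by multiples of `z` stays in the
defining set and shifts the coordinate. -/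
theorem zeroCount_of_notMem_range_algebraMap (C : K → Prop) (a : F) {b : F}
    (hb : b ∉ LinearMap.range (Algebra.linearMap K F)) :
    zeroCount σ C a b * Fintype.card K = solCount (InDefiningSet σ C) := by
  obtain ⟨z, hz, hzb⟩ := exists_trace_mul_ne_zero _ hb
  have hz1 : Algebra.trace K F z = 0 := by simpa using hz 1 ⟨1, by simp⟩
  refine solCount_shift _ _ ((0, z) : F × F) hzb ?_ ?_ 0
  · rintro ⟨x, y⟩ t ⟨h, h'⟩
    refine ⟨by simpa using h, ?_⟩
    simpa [hz1] using h'
  · rintro ⟨x, y⟩ t -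
    simp only [Prod.smul_mk, smul_zero, Prod.mk_add_mk, add_zero, mul_add, map_add,
      mul_smul_comm, LinearMap.map_smul, smul_eq_mul, mul_comm z b]
    ring

/-- Some `z` in the radical has `Tr (a z) ≠ 0`; translating `x₁` by multiples of `z` leaves `Q`
unchanged and shifts the coordinate. -/
theorem zeroCount_of_notMem_range_twistedAdjoint (h2 : (2 : K) ≠ 0) (C : K → Prop) {a : F} (b : F)
    (ha : a ∉ LinearMap.range (twistedAdjoint σ)) :
    zeroCount σ C a b * Fintype.card K = solCount (InDefiningSet σ C) := by
  obtain ⟨z, hz, hza⟩ := exists_mem_ker_twistedAdjoint σ ha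
  have hz' := (polar_twistedTraceForm_eq_zero_iff σ z).2 hz
  have hz1 := map_eq_zero_of_polar_eq_zero _ h2 hz'
  refine solCount_shift _ _ ((z, 0) : F × F) hza ?_ ?_ 0
  · rintro ⟨x, y⟩ t ⟨h, h'⟩
    refine ⟨?_, by simpa using h'⟩
    change twistedTraceForm σ (x + t • z) = 1
    rw [QuadraticMap.map_add (twistedTraceForm σ), QuadraticMap.map_smul, polar_smul_right,
      polar_comm, hz', hz1]
    simpa using h
  · rintro ⟨x, y⟩ t -
    simp only [Prod.smul_mk, smul_zero, Prod.mk_add_mk, add_zero, mul_add, map_add,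
      mul_smul_comm, LinearMap.map_smul, smul_eq_mul]
    ring

theorem zeroCount_zero_right {K F : Type*} [Field K] [Field F] [Fintype F] [Algebra K F]
    (σ : F ≃ₐ[K] F) (C : K → Prop) (a : F) :
    zeroCount σ C a 0 = sectionCount σ a * solCount fun x => C (Algebra.trace K F x) := by
  rw [sectionCount, ← solCount_prod_and]
  refine solCount_congr fun x => ?_
  simp only [InDefiningSet, zero_mul, add_zero]
  tauto

theorem two_mul_solCount_trace (h0 : ¬ C 0) (hC : ∀ t ≠ 0, (C (-t) ↔ ¬ C t)) :
    2 * Fintype.card K * (solCount fun x => C (Algebra.trace K F x)) + Fintype.card F =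
      Fintype.card F * Fintype.card K := by
  classical
  have h := solCount_fiberwise (fun x => C (Algebra.trace K F x)) (Algebra.trace K F)
  have h1 : ∀ t, Fintype.card K *
      (solCount fun x => C (Algebra.trace K F x) ∧ Algebra.trace K F x = t)
      = if C t then Fintype.card F else 0 := by
    intro t
    split_ifs with ht
    · rw [mul_comm, ← solCount_linear _ (Algebra.trace_ne_zero K F) t]
      congr 1
      refine solCount_congr fun x => ⟨fun h => h.2, ?_⟩
      rintro rfl
      exact ⟨ht, rfl⟩
    · rw [solCount_false, mul_zero]
      rintro x ⟨h, rfl⟩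
      exact ht h
  rw [h, mul_assoc, Finset.mul_sum, Finset.sum_congr rfl fun t _ => h1 t]
  have := two_mul_sum_half h0 hC (fun _ => Fintype.card F) (by simp)
  rw [this]
  simp [mul_comm]

/-- The coordinate vanishes when `Tr (a x₁) = -β * Tr x₂`. The number of `x₁` with `Q x₁ = 1` and
`Tr (a x₁) = β t` is even as a function of `t`, by `x₁ ↦ -x₁`. So its sum over `C` is half its sum
over all `t ≠ 0`. -/
theorem two_mul_zeroCount_algebraMap (h0 : ¬ C 0) (hC : ∀ t ≠ 0, (C (-t) ↔ ¬ C t)) (a : F) {β : K}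
    (hβ : β ≠ 0) :
    2 * Fintype.card K * zeroCount σ C a (algebraMap K F β) +
      Fintype.card F * sectionCount σ a =
      Fintype.card F * solCount fun x => twistedTraceForm σ x = 1 := by
  classical
  set g : K → ℕ := fun t => solCount fun x =>
    twistedTraceForm σ x = 1 ∧ Algebra.trace K F (a * x) = β * t with hg
  have e1 : zeroCount σ C a (algebraMap K F β) = solCount fun x : F × F =>
      C (Algebra.trace K F x.1) ∧ twistedTraceForm σ x.2 = 1 ∧
        Algebra.trace K F (a * x.2) = β * -Algebra.trace K F x.1 := by
    refine solCount_equiv (Equiv.prodComm F F) fun x => ?_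
    simp only [InDefiningSet, Equiv.prodComm_apply, Prod.fst_swap, Prod.snd_swap, map_add,
      ← Algebra.smul_def, LinearMap.map_smul, smul_eq_mul, mul_neg, eq_neg_iff_add_eq_zero]
    tauto
  have hgneg : ∀ t, g (-t) = g t := fun t => by
    refine solCount_equiv (Equiv.neg F) fun x => ?_
    simp [neg_eq_iff_eq_neg]
  have e2 : ∀ t, Fintype.card K * (solCount fun x : F × F => (C (Algebra.trace K F x.1) ∧
      twistedTraceForm σ x.2 = 1 ∧ Algebra.trace K F (a * x.2) = β * -Algebra.trace K F x.1) ∧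
        Algebra.trace K F x.1 = t) = Fintype.card F * if C t then g t else 0 := by
    intro t
    split_ifs with ht
    · rw [← solCount_linear _ (Algebra.trace_ne_zero K F) t, ← hgneg, mul_comm, mul_right_comm,
        hg, ← solCount_prod_and]
      congr 1
      refine solCount_congr fun x => ?_
      constructor
      · rintro ⟨⟨-, h2, h3⟩, rfl⟩
        exact ⟨rfl, h2, h3⟩
      · rintro ⟨rfl, h2, h3⟩
        exact ⟨⟨ht, h2, h3⟩, rfl⟩
    · rw [solCount_false]
      · simp
      · rintro x ⟨⟨h, -⟩, rfl⟩
        exact ht h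
  have e3 : 2 * ∑ t, (if C t then g t else 0) + sectionCount σ a
      = solCount fun x => twistedTraceForm σ x = 1 := by
    have hs : sectionCount σ a = g 0 := by simp [hg, sectionCount]
    rw [hs, two_mul_sum_half h0 hC g hgneg,
      solCount_fiberwise _ (fun x => Algebra.trace K F (a * x))]
    exact Fintype.sum_equiv (Equiv.mulLeft₀ β hβ) _ _ fun t => rfl
  rw [e1, solCount_fiberwise _ (fun x : F × F => Algebra.trace K F x.1), mul_assoc, Finset.mul_sum,
    Finset.sum_congr rfl fun t _ => e2 t, ← Finset.mul_sum, ← e3]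
  ring

theorem sectionCount_zero {K F : Type*} [Field K] [Field F] [Algebra K F]
    (σ : F ≃ₐ[K] F) : sectionCount σ 0 = solCount fun x => twistedTraceForm σ x = 1 :=
  solCount_congr fun x => by simp

theorem sectionCount_twistedAdjoint {K F : Type*} [Field K] [Field F] [Algebra K F]
    (σ : F ≃ₐ[K] F) (c : F) :
    sectionCount σ (twistedAdjoint σ c) = orthCount (twistedTraceForm σ) c 1 :=
  solCount_congr fun x => by rw [polar_twistedTraceForm]

-- Three cases: for `Q c` a nonzero square or a nonsquare, the value `1` lies in the square class of
-- `Q c` or of `-Q c`, and `orthCount_eq` applies. The isotropic case yields the same number as the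
-- nonzero squares.
open Classical in
theorem card_sq_mul_sectionCount (h2 : ringChar K ≠ 2) (hneg : ¬ IsSquare (-1 : K)) {N : ℕ}
    (hN : ∀ v ≠ 0, (solCount fun x => twistedTraceForm σ x = v) = N) {c : F}
    (hc : twistedAdjoint σ c ≠ 0) :
    (Fintype.card K : ℤ) ^ 2 * (N - sectionCount σ (twistedAdjoint σ c)) =
      (Fintype.card K - 1) * Fintype.card F + if IsSquare (twistedTraceForm σ c) then (0 : ℤ) else
        2 * Fintype.card K * (Fintype.card K * N - Fintype.card F) := by
  have h1 : quadraticChar K (-1) = -1 := quadraticChar_neg_one_iff_not_isSquare.2 hneg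
  rw [sectionCount_twistedAdjoint]
  by_cases hq : twistedTraceForm σ c = 0
  · have hl : polarBilin (twistedTraceForm σ) c ≠ 0 := fun h =>
      hc ((polar_twistedTraceForm_eq_zero_iff σ c).1 fun x => by
        simpa using LinearMap.congr_fun h x)
    rw [hq, if_pos (IsSquare.zero), add_zero, orthCount]
    have e1 := solCount_fiberwise (fun x => twistedTraceForm σ x = 1)
      (fun x => polar (twistedTraceForm σ) c x)
    rw [hN 1 one_ne_zero, ← Finset.add_sum_erase _ _ (Finset.mem_univ (0 : K))] at e1
    -- As `Q c = 0`, translation along `c` preserves `polar Q c x = u` and shifts `Q` at rate `u ≠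
    -- 0`, so `Q` is equidistributed on that affine hyperplane. The section `u = 0` is what remains
    -- of `N`.
    have e2 : ∀ u ∈ Finset.univ.erase (0 : K), (solCount fun x => twistedTraceForm σ x = 1 ∧
        polar (twistedTraceForm σ) c x = u) * Fintype.card K ^ 2 = Fintype.card F := by
      intro u hu
      rw [← solCount_linear _ hl u, pow_two, ← mul_assoc]
      congr 1
      rw [← solCount_shift (fun x => polarBilin (twistedTraceForm σ) c x = u) (twistedTraceForm σ) c
        (Finset.ne_of_mem_erase hu) ?_ ?_ 1]
      · congr 1
        refine solCount_congr fun x => ?_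
        simp [and_comm]
      · intro x t hx
        rw [polarBilin_apply_apply] at hx ⊢
        rw [polar_add_right, polar_smul_right, polar_self, hq, hx]
        simp
      · intro x t hx
        rw [polarBilin_apply_apply] at hx
        rw [QuadraticMap.map_add (twistedTraceForm σ), QuadraticMap.map_smul, polar_smul_right,
          polar_comm, hx, hq]
        simp
    have e3 := congrArg (fun j : ℕ => (j : ℤ)) (Finset.sum_congr rfl e2)
    simp only [← Finset.sum_mul, Finset.sum_const, smul_eq_mul] at e3
    rw [Finset.card_erase_of_mem (Finset.mem_univ _), Finset.card_univ] at e3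
    push_cast [Nat.cast_sub Fintype.card_pos] at e3
    zify at e1
    rw [e1]
    linear_combination e3
  · obtain ⟨ha, hb⟩ := orthCount_eq (twistedTraceForm σ) h2 h1 hN hq
    rcases quadraticChar_dichotomy hq with h | h
    · have hs := (quadraticChar_one_iff_isSquare hq).1 h
      rw [if_pos hs]
      obtain ⟨r, hr⟩ := hs
      have hr0 : r ≠ 0 := by
        rintro rfl
        simp [hr] at hq
      rw [show orthCount (twistedTraceForm σ) c (twistedTraceForm σ c)
        = orthCount (twistedTraceForm σ) c 1 by
          rw [← orthCount_sq_mul (twistedTraceForm σ) c hr0 1, mul_one, pow_two, ← hr]] at ha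
      linear_combination -ha
    · rw [if_neg (quadraticChar_neg_one_iff_not_isSquare.1 h)]
      have hs : quadraticChar K (-twistedTraceForm σ c) = 1 := by
        rw [neg_eq_neg_one_mul, map_mul, h, h1]
        norm_num
      obtain ⟨r, hr⟩ := (quadraticChar_one_iff_isSquare (neg_ne_zero.2 hq)).1 hs
      have hr0 : r ≠ 0 := by
        rintro rfl
        simp at hr
        exact hq hr
      rw [show orthCount (twistedTraceForm σ) c (-twistedTraceForm σ c)
        = orthCount (twistedTraceForm σ) c 1 by
          rw [← orthCount_sq_mul (twistedTraceForm σ) c hr0 1, mul_one, pow_two, ← hr]] at hb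
      linear_combination -hb

/-- A property that is constant on cosets of the kernel of a linear map is counted on the image. -/
theorem solCount_eq_mul_image {K V W : Type*} [Field K] [AddCommGroup V] [Fintype V] [AddCommGroup W]
    [Fintype W] [Module K V] [Module K W] (A : V →ₗ[K] W) (P : V → Prop)
    (hP : ∀ x z, A z = 0 → P x → P (x + z)) :
    solCount P = (solCount fun z => A z = 0) * solCount fun a => ∃ c, A c = a ∧ P c := by
  classical
  rw [solCount_fiberwise P A, solCount_eq_card_filter (fun a => ∃ c, A c = a ∧ P c), mul_comm,
    ← smul_eq_mul, ← Finset.sum_const, Finset.sum_filter]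
  refine Finset.sum_congr rfl fun a _ => ?_
  split_ifs with h
  · obtain ⟨c, rfl, hc⟩ := h
    refine (solCount_equiv (Equiv.addLeft c) fun z => ?_).symm
    simp only [Equiv.coe_addLeft, map_add, add_eq_left]
    exact ⟨fun hz => ⟨hP _ _ hz hc, hz⟩, fun hz => hz.2⟩
  · refine solCount_false ?_
    rintro x ⟨hx, rfl⟩
    exact h ⟨x, rfl, hx⟩

/-- The images under `twistedAdjoint σ` of the vectors with nonsquare value. -/
def IsNonsquareImage (a : F) : Prop :=
  ∃ c, twistedAdjoint σ c = a ∧ ¬ IsSquare (twistedTraceForm σ c)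

theorem twistedTraceForm_add_of_mem_ker (h2 : (2 : K) ≠ 0) (x : F) {z : F}
    (hz : twistedAdjoint σ z = 0) : twistedTraceForm σ (x + z) = twistedTraceForm σ x := by
  have hz' := (polar_twistedTraceForm_eq_zero_iff σ z).2 hz
  rw [QuadraticMap.map_add (twistedTraceForm σ), polar_comm, hz',
    map_eq_zero_of_polar_eq_zero _ h2 hz', add_zero, add_zero]

theorem isNonsquareImage_twistedAdjoint_iff (h2 : (2 : K) ≠ 0) (c : F) :
    IsNonsquareImage σ (twistedAdjoint σ c) ↔ ¬ IsSquare (twistedTraceForm σ c) := by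
  refine ⟨?_, fun h => ⟨c, rfl, h⟩⟩
  rintro ⟨c', hc', h⟩
  have := twistedTraceForm_add_of_mem_ker σ h2 c (z := c' - c) (by rw [map_sub, hc', sub_self])
  rw [add_sub_cancel] at this
  rwa [← this]

theorem radCard_eq : radCard (twistedTraceForm σ) = solCount fun z => twistedAdjoint σ z = 0 :=
  solCount_congr (polar_twistedTraceForm_eq_zero_iff σ)

theorem radCard_mul_solCount_range : radCard (twistedTraceForm σ) *
    (solCount fun a => a ∈ LinearMap.range (twistedAdjoint σ)) = Fintype.card F := by
  have := solCount_eq_mul_image (twistedAdjoint σ) (fun _ => True) (by simp)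
  rw [radCard_eq, ← solCount_true, this]
  congr 1
  exact solCount_congr fun a => by simp

/-- Half of the nonzero scalars are nonsquares, each taken `N` times by the form; the form is
constant on cosets of the radical, which are the fibres over the image. -/
theorem two_mul_radCard_mul_solCount_isNonsquareImage (h2 : (2 : K) ≠ 0)
    {N : ℕ}
    (hN : ∀ v ≠ 0, (solCount fun x => twistedTraceForm σ x = v) = N)
    (hC : ∀ t : K, t ≠ 0 → (¬ IsSquare (-t) ↔ ¬ ¬ IsSquare t)) :
    2 * (radCard (twistedTraceForm σ) * solCount (IsNonsquareImage σ)) + N =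
      Fintype.card K * N := by
  classical
  have h := solCount_eq_mul_image (twistedAdjoint σ) (fun c => ¬ IsSquare (twistedTraceForm σ c))
    (fun x z hz hx => by rwa [twistedTraceForm_add_of_mem_ker σ h2 x hz])
  have h3 : (solCount fun c => ¬ IsSquare (twistedTraceForm σ c))
      = ∑ v : K, if IsSquare v then 0 else N := by
    rw [solCount_fiberwise _ (twistedTraceForm σ)]
    refine Finset.sum_congr rfl fun v _ => ?_
    split_ifs with hv
    · refine solCount_false ?_
      rintro x ⟨h, rfl⟩
      exact h hv
    · rw [← hN v (by rintro rfl; simp at hv)]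
      refine solCount_congr fun x => ⟨fun h => h.2, ?_⟩
      rintro rfl
      exact ⟨hv, rfl⟩
  have h4 := two_mul_sum_half (C := fun t : K => ¬ IsSquare t) (by simp) hC (fun _ => N) (by simp)
  change _ = _ * solCount (IsNonsquareImage σ) at h
  rw [radCard_eq, ← h, h3]
  refine Eq.trans ?_ (h4.trans (by simp))
  congr 2
  refine Finset.sum_congr rfl fun v _ => ?_
  by_cases hv : IsSquare v <;> simp [hv]

end ZeroCounts

/-! ### Squares and nonsquares modulo `p ≡ 3 (mod 4)` -/

section ResidueClasses

variable {p : ℕ} [Fact p.Prime]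

theorem zero_notMem_cyclotomicClass (i : Fin 2) : (0 : ZMod p) ∉ cyclotomicClass p i := by
  unfold cyclotomicClass
  split_ifs <;> simp

theorem isSquare_neg_iff (hp : p % 4 = 3) {t : ZMod p} (ht : t ≠ 0) :
    IsSquare (-t) ↔ ¬ IsSquare t := by
  have h1 : ¬ IsSquare (-1 : ZMod p) := by
    rw [ZMod.exists_sq_eq_neg_one_iff]
    simpa using hp
  have hm : quadraticChar (ZMod p) (-1) = -1 := quadraticChar_neg_one_iff_not_isSquare.2 h1
  rw [← quadraticChar_one_iff_isSquare (neg_ne_zero.2 ht),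
    ← quadraticChar_neg_one_iff_not_isSquare, neg_eq_neg_one_mul, map_mul, hm]
  omega

theorem neg_mem_cyclotomicClass (hp : p % 4 = 3) (i : Fin 2) (t : ZMod p) (ht : t ≠ 0) :
    -t ∈ cyclotomicClass p i ↔ ¬ t ∈ cyclotomicClass p i := by
  unfold cyclotomicClass
  split_ifs <;> simp [ht, isSquare_neg_iff hp ht]

end ResidueClasses

/-! ### Weights of codewords as numbers of nonzero coordinates -/

section Code

variable (p : ℕ) [Fact p.Prime] (F : Type*) [Field F] [Fintype F] [Algebra (ZMod p) F]

/-- The automorphism `x ↦ x ^ (p ^ l)`. -/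
noncomputable def frobeniusPow (l : ℕ) : F ≃ₐ[ZMod p] F :=
  FiniteField.frobeniusAlgEquivOfAlgebraic (ZMod p) F ^ l

variable {F}

theorem frobeniusPow_apply (l : ℕ) (x : F) : frobeniusPow p F l x = x ^ p ^ l := by
  rw [frobeniusPow, AlgEquiv.coe_pow, FiniteField.coe_frobeniusAlgEquivOfAlgebraic, pow_iterate,
    ZMod.card]

theorem mem_definingSet_iff (l : ℕ) (i : Fin 2) (x : F × F) : x ∈ definingSet p F l i ↔
    InDefiningSet (frobeniusPow p F l) (· ∈ cyclotomicClass p i) x := by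
  simp only [definingSet, Finset.mem_filter, Finset.mem_univ, true_and, InDefiningSet,
    twistedTraceForm_apply, frobeniusPow_apply, pow_succ' x.1]

theorem card_definingSet (l : ℕ) (i : Fin 2) : (definingSet p F l i).card =
    solCount (InDefiningSet (frobeniusPow p F l) (· ∈ cyclotomicClass p i)) := by
  classical
  rw [solCount_eq_card_filter]
  congr 1
  ext x
  simp [mem_definingSet_iff]

theorem hammingNorm_codewordMap_add (l : ℕ) (i : Fin 2) (a b : F) :
    hammingNorm (codewordMap p F (definingSet p F l i) (a, b)) +
      zeroCount (frobeniusPow p F l) (· ∈ cyclotomicClass p i) a b =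
      (definingSet p F l i).card := by
  classical
  have h1 := solCount_add_not (fun _ : definingSet p F l i => True)
    (fun x => codewordMap p F (definingSet p F l i) (a, b) x = 0)
  simp only [true_and, solCount_true, Fintype.card_coe] at h1
  rw [← h1, add_comm]
  congr 1
  · rw [zeroCount]
    refine (solCount_congr (R := fun x => x ∈ definingSet p F l i ∧ _) fun x => by
      rw [mem_definingSet_iff]).trans ?_
    exact (Nat.card_congr (Equiv.subtypeSubtypeEquivSubtypeInter (· ∈ definingSet p F l i)
      fun x : F × F => Algebra.trace (ZMod p) F (a * x.1 + b * x.2) = 0)).symm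
  · rw [solCount_eq_card_filter, hammingNorm]

end Code

/-! ### Weights and multiplicities of the rows -/

section Table

variable {p : ℕ} [Fact p.Prime] {F : Type*} [Field F] [Fintype F] [Algebra (ZMod p) F]
  (σ : F ≃ₐ[ZMod p] F)

open Classical in
/-- The row of the table to which the word attached to `(a, b)` belongs. -/
noncomputable def tableRow (x : F × F) : Fin 7 :=
  if x.1 ∈ LinearMap.range (twistedAdjoint σ) ∧
      x.2 ∈ LinearMap.range (Algebra.linearMap (ZMod p) F) then
    if x.1 = 0 then if x.2 = 0 then 0 else 1
    else if IsNonsquareImage σ x.1 then if x.2 = 0 then 4 else 6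
    else if x.2 = 0 then 3 else 5
  else 2

variable {e m s N : ℕ}

theorem cast_pow_sub (p : ℕ) [Fact p.Prime] {a b : ℕ} (h : b ≤ a) :
    (p : ℚ) ^ (a - b) = p ^ a / p ^ b := by
  rw [pow_sub₀ _ (by exact_mod_cast (Fact.out : p.Prime).ne_zero) h, div_eq_mul_inv]

/-- Clears the truncated exponents, so that the entries become rational functions of `p`, `q` and `d
= p ^ (m + s)`, the excess of `p N` over `q`. -/
theorem tableWeight_eq (hem : e = 2 * m) (hs : 0 < s) (hsm : s + 1 ≤ m) {P n d : ℚ}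
    (hP : P = p) (hn : n = p ^ e) (hd : d = p ^ (m + s)) : tableWeight p e m s =
      ![0, (P - 1) / 2 * ((n ^ 2 + n * d) / P ^ 2), (P - 1) ^ 2 / 2 * ((n ^ 2 + n * d) / P ^ 3),
        (P - 1) ^ 2 / 2 * (n ^ 2 / P ^ 3),
        (P - 1) ^ 2 / 2 * (n ^ 2 / P ^ 3) + (P - 1) * (n * d / P ^ 2),
        (P - 1) ^ 2 / 2 * (n ^ 2 / P ^ 3) + (P - 1) / 2 * (n * d / P ^ 2),
        (P - 1) ^ 2 / 2 * (n ^ 2 / P ^ 3) + (P - 3) / 2 * (n * d / P ^ 2)] := by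
  have h1 : n ^ 2 = (p : ℚ) ^ (2 * e) := by rw [hn]; ring
  have h2 : n * d = (p : ℚ) ^ (e + m + s) := by rw [hn, hd]; ring
  rw [tableWeight, cast_pow_sub p (by omega), cast_pow_sub p (by omega), cast_pow_sub p (by omega),
    cast_pow_sub p (by omega), h1, h2, hP, add_div, add_div]

theorem tableMult_eq (hem : e = 2 * m) (hsm : s + 1 ≤ m) {P n d R : ℚ}
    (hP : P = p) (hn : n = p ^ e) (hd : d = p ^ (m + s)) (hR : R = p ^ (2 * s)) :
    tableMult p e m s =
      ![1, P - 1, n * (n - P / R), (n / R + n / (R * P) - d / R + d / (R * P) - 2) / 2,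
        (n / R - n / (R * P) + d / R - d / (R * P)) / 2,
        (P - 1) * (n / R + n / (R * P) - d / R + d / (R * P) - 2) / 2,
        (P - 1) * (n / R - n / (R * P) + d / R - d / (R * P)) / 2] := by
  have hp0 : (p : ℚ) ≠ 0 := by exact_mod_cast (Fact.out : p.Prime).ne_zero
  have h1 : (p : ℚ) ^ (m - s) = d / R := by
    rw [hd, hR, ← cast_pow_sub p (by omega)]
    congr 1
    omega
  have h2 : (p : ℚ) ^ (m - s - 1) = d / (R * P) := by
    rw [hd, hR, hP, ← pow_succ, ← cast_pow_sub p (by omega)]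
    congr 1
    omega
  have h3 : (p : ℚ) ^ (e - 2 * s - 1) = n / (R * P) := by
    rw [hn, hR, hP, ← pow_succ, ← cast_pow_sub p (by omega)]
    congr 1
  have h4 : (p : ℚ) ^ (1 - 2 * (s : ℤ)) = P / R := by
    rw [zpow_sub₀ hp0, hP, hR, zpow_one]
    congr 1
  rw [tableMult, h1, h2, h3, h4, cast_pow_sub p (by omega), ← hn, ← hR, ← hP]

theorem card_weight_eq_tableWeight (hp : p % 4 = 3) (hcard : Fintype.card F = p ^ e)
    (hem : e = 2 * m) (hs : 0 < s) (hsm : s + 1 ≤ m)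
    (hN : ∀ v ≠ 0, (solCount fun x => twistedTraceForm σ x = v) = N)
    (hPN : p * N = p ^ e + p ^ (m + s)) (i : Fin 2) :
    (solCount (InDefiningSet σ (· ∈ cyclotomicClass p i)) : ℚ) = tableWeight p e m s 1 ∧
    ∀ a b, (solCount (InDefiningSet σ (· ∈ cyclotomicClass p i)) : ℚ) -
      zeroCount σ (· ∈ cyclotomicClass p i) a b = tableWeight p e m s (tableRow σ (a, b)) := by
  classical
  have hp2 : ringChar (ZMod p) ≠ 2 := by
    rw [ZMod.ringChar_zmod_n]
    rintro rfl
    omega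
  have h2 : (2 : ZMod p) ≠ 0 := Ring.two_ne_zero hp2
  have hm : ¬ IsSquare (-1 : ZMod p) := fun h =>
    (isSquare_neg_iff hp one_ne_zero).1 h IsSquare.one
  have h0 := zero_notMem_cyclotomicClass (p := p) i
  have hC := neg_mem_cyclotomicClass hp i
  have hp0 : (p : ℚ) ≠ 0 := by exact_mod_cast (Fact.out : p.Prime).ne_zero
  have hD := solCount_inDefiningSet σ (· ∈ cyclotomicClass p i)
  have hT := two_mul_solCount_trace (K := ZMod p) (F := F) h0 hC
  rw [hN 1 one_ne_zero] at hD
  rw [ZMod.card, hcard] at hT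
  rw [tableWeight_eq hem hs hsm rfl rfl rfl, hD]
  set T := solCount fun x : F => Algebra.trace (ZMod p) F x ∈ cyclotomicClass p i with hTdef
  have hTq : (T : ℚ) = p ^ e * (p - 1) / (2 * p) := by
    rw [eq_div_iff (by positivity)]
    have : (2 * p * T + p ^ e : ℚ) = p ^ e * p := by exact_mod_cast hT
    linear_combination this
  have hNq : (N : ℚ) = (p ^ e + p ^ (m + s)) / p := by
    rw [eq_div_iff hp0]
    have : (p * N : ℚ) = p ^ e + p ^ (m + s) := by exact_mod_cast hPN
    linear_combination this
  have hsec : ∀ c, twistedAdjoint σ c ≠ 0 → (sectionCount σ (twistedAdjoint σ c) : ℚ) = N -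
      ((p - 1) * p ^ e + if IsNonsquareImage σ (twistedAdjoint σ c) then
        2 * p * (p : ℚ) ^ (m + s) else 0) / p ^ 2 := by
    intro c hc
    have h := card_sq_mul_sectionCount σ hp2 hm hN hc
    rw [ZMod.card, hcard] at h
    have hdelta : (p * N : ℤ) - (p ^ e : ℕ) = p ^ (m + s) := by
      have : (p * N : ℤ) = p ^ e + p ^ (m + s) := by exact_mod_cast hPN
      push_cast
      linear_combination this
    rw [hdelta] at h
    rw [isNonsquareImage_twistedAdjoint_iff σ h2, eq_sub_iff_add_eq, ← eq_sub_iff_add_eq',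
      div_eq_iff (by positivity)]
    have h' := congrArg (fun z : ℤ => (z : ℚ)) h
    by_cases hq : IsSquare (twistedTraceForm σ c)
    · simp only [hq, not_true, if_true, if_false] at h' ⊢
      push_cast at h'
      linear_combination -h'
    · simp only [hq, not_false_eq_true, if_true, if_false] at h' ⊢
      push_cast at h'
      linear_combination -h'
  refine ⟨?_, fun a b => ?_⟩
  · rw [Nat.cast_mul, hTq, hNq]
    simp
    field_simp
  by_cases hab : a ∈ LinearMap.range (twistedAdjoint σ) ∧
      b ∈ LinearMap.range (Algebra.linearMap (ZMod p) F)
  · obtain ⟨⟨c, rfl⟩, ⟨β, rfl⟩⟩ := hab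
    have hb0 : Algebra.linearMap (ZMod p) F β = 0 ↔ β = 0 := by simp
    have hz : ∀ γ : ZMod p, γ ≠ 0 → (zeroCount σ (· ∈ cyclotomicClass p i) (twistedAdjoint σ c)
        (Algebra.linearMap (ZMod p) F γ) : ℚ) =
        p ^ e * (N - sectionCount σ (twistedAdjoint σ c)) / (2 * p) := by
      intro γ hγ
      have h := two_mul_zeroCount_algebraMap σ h0 hC (twistedAdjoint σ c) hγ
      rw [hN 1 one_ne_zero, ZMod.card, hcard] at h
      rw [eq_div_iff (by positivity)]
      have h' := congrArg (fun z : ℕ => (z : ℚ)) h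
      push_cast at h'
      rw [Algebra.linearMap_apply]
      linear_combination h'
    have hz0 : (zeroCount σ (· ∈ cyclotomicClass p i) (twistedAdjoint σ c)
        (Algebra.linearMap (ZMod p) F 0) : ℚ) = sectionCount σ (twistedAdjoint σ c) * T := by
      rw [map_zero, zeroCount_zero_right, Nat.cast_mul]
    simp only [tableRow, LinearMap.mem_range_self, true_and, if_true, hb0]
    rw [Nat.cast_mul]
    by_cases ha0 : twistedAdjoint σ c = 0
    · rw [if_pos ha0]
      have hsz : (sectionCount σ (twistedAdjoint σ c) : ℚ) = N := by
        rw [ha0, sectionCount_zero, hN 1 one_ne_zero]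
      by_cases hβ : β = 0
      · rw [if_pos hβ, hβ, hz0, hsz]
        simp
      · rw [if_neg hβ, hz β hβ, hsz, hTq, hNq]
        simp
        field_simp
    · rw [if_neg ha0]
      have hse := hsec c ha0
      by_cases hn : IsNonsquareImage σ (twistedAdjoint σ c)
      · rw [if_pos hn] at hse ⊢
        by_cases hβ : β = 0
        · rw [if_pos hβ, hβ, hz0, hse, hTq, hNq]
          simp
          field_simp
          ring
        · rw [if_neg hβ, hz β hβ, hse, hTq, hNq]
          simp
          field_simp
          ring
      · rw [if_neg hn] at hse ⊢
        by_cases hβ : β = 0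
        · rw [if_pos hβ, hβ, hz0, hse, hTq, hNq]
          simp
          field_simp
          ring
        · rw [if_neg hβ, hz β hβ, hse, hTq, hNq]
          simp
          field_simp
          ring
  · have hz : (zeroCount σ (· ∈ cyclotomicClass p i) a b : ℚ) = N * T / p := by
      have h : zeroCount σ (· ∈ cyclotomicClass p i) a b * Fintype.card (ZMod p) =
          solCount (InDefiningSet σ (· ∈ cyclotomicClass p i)) := by
        by_cases ha : a ∈ LinearMap.range (twistedAdjoint σ)
        · exact zeroCount_of_notMem_range_algebraMap σ _ a fun hb => hab ⟨ha, hb⟩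
        · exact zeroCount_of_notMem_range_twistedAdjoint σ h2 _ b ha
      rw [ZMod.card, hD] at h
      rw [eq_div_iff hp0]
      exact_mod_cast h
    simp only [tableRow, hab, if_false]
    rw [Nat.cast_mul, hz, hTq, hNq]
    simp
    field_simp

-- Every row except row `2` is a product of a condition on `a` and a condition on `b`; row `2` is
-- the complement of (range of the adjoint) × (prime field). The sizes of the factors come from the
-- radical, from `N` and from `p`.
set_option maxHeartbeats 1000000 in
theorem solCount_tableRow (hp : p % 4 = 3) (hcard : Fintype.card F = p ^ e)
    (hem : e = 2 * m) (hsm : s + 1 ≤ m)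
    (hN : ∀ v ≠ 0, (solCount fun x => twistedTraceForm σ x = v) = N)
    (hPN : p * N = p ^ e + p ^ (m + s)) (hR : radCard (twistedTraceForm σ) = p ^ (2 * s))
    (j : Fin 7) : (solCount (fun x => tableRow σ x = j) : ℚ) = tableMult p e m s j := by
  classical
  have h2 : (2 : ZMod p) ≠ 0 := by
    refine Ring.two_ne_zero ?_
    rw [ZMod.ringChar_zmod_n]
    rintro rfl
    omega
  have hp0 : (p : ℚ) ≠ 0 := by exact_mod_cast (Fact.out : p.Prime).ne_zero
  have hNq : (N : ℚ) = (p ^ e + p ^ (m + s)) / p := by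
    rw [eq_div_iff hp0]
    have : (p * N : ℚ) = p ^ e + p ^ (m + s) := by exact_mod_cast hPN
    linear_combination this
  set W := LinearMap.range (twistedAdjoint σ) with hW
  set L := LinearMap.range (Algebra.linearMap (ZMod p) F) with hL
  have hnsW : ∀ a, IsNonsquareImage σ a → a ∈ W := by
    rintro _ ⟨c, rfl, -⟩
    exact ⟨c, rfl⟩
  have hns0 : ¬ IsNonsquareImage σ 0 := by
    rw [← map_zero (twistedAdjoint σ), isNonsquareImage_twistedAdjoint_iff σ h2]
    simp
  have cW : (solCount (· ∈ W) : ℚ) = p ^ e / p ^ (2 * s) := by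
    have h := radCard_mul_solCount_range σ
    rw [hR, hcard] at h
    rw [eq_div_iff (by positivity), mul_comm]
    exact_mod_cast h
  have cB : (solCount (IsNonsquareImage σ) : ℚ) =
      (p - 1) * (p ^ e + p ^ (m + s)) / (2 * p * p ^ (2 * s)) := by
    have h := two_mul_radCard_mul_solCount_isNonsquareImage σ h2 hN
      fun t ht => by rw [isSquare_neg_iff hp ht]
    rw [hR, ZMod.card] at h
    have h' := congrArg (fun z : ℕ => (z : ℚ)) h
    push_cast at h'
    rw [hNq] at h'
    field_simp at h' ⊢
    linear_combination h'
  have cG : (solCount (fun a => (a ∈ W ∧ ¬ IsNonsquareImage σ a) ∧ ¬ a = 0) : ℚ) =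
      p ^ e / p ^ (2 * s) - 1 - (p - 1) * (p ^ e + p ^ (m + s)) / (2 * p * p ^ (2 * s)) := by
    have h1 := solCount_add_not (· ∈ W) (IsNonsquareImage σ)
    have h3 := solCount_add_not (fun a => a ∈ W ∧ ¬ IsNonsquareImage σ a) (fun a => a = 0)
    rw [solCount_congr (R := IsNonsquareImage σ) fun a => ⟨fun h => h.2, fun h => ⟨hnsW a h, h⟩⟩]
      at h1
    rw [solCount_congr (R := fun a => a = 0) (fun a => ⟨fun h => h.2, by
      rintro rfl
      exact ⟨⟨W.zero_mem, hns0⟩, rfl⟩⟩), solCount_eq_one] at h3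
    rw [← cW, ← cB, ← h1, ← h3]
    push_cast
    ring
  have cL : solCount (· ∈ L) = p := by
    refine Eq.trans ?_ ((solCount_true (ZMod p)).trans (ZMod.card p))
    exact (Nat.card_congr ((Equiv.Set.univ _).trans
      (Equiv.ofInjective _ (algebraMap (ZMod p) F).injective))).symm
  have cL0 : (solCount (fun b => b ∈ L ∧ ¬ b = 0) : ℚ) = p - 1 := by
    have h3 := solCount_add_not (· ∈ L) (fun b => b = 0)
    rw [solCount_congr (R := fun a => a = 0) (fun a => ⟨fun h => h.2, by
      rintro rfl
      exact ⟨L.zero_mem, rfl⟩⟩), solCount_eq_one, cL] at h3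
    have h4 := congrArg (fun z : ℕ => (z : ℚ)) h3
    push_cast at h4
    linear_combination h4
  have key : ∀ (j : Fin 7) (A B : F → Prop),
      (∀ a b, tableRow σ (a, b) = j ↔ A a ∧ B b) →
      (solCount (fun x => tableRow σ x = j) : ℚ) = solCount A * solCount B := by
    intro j A B h
    rw [← Nat.cast_mul, ← solCount_prod_and]
    exact congrArg _ (solCount_congr fun x => h x.1 x.2)
  have hrow : ∀ a b, tableRow σ (a, b) = if a ∈ W ∧ b ∈ L then
      if a = 0 then if b = 0 then 0 else 1
      else if IsNonsquareImage σ a then if b = 0 then 4 else 6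
      else if b = 0 then 3 else 5 else 2 := fun a b => rfl
  have hW0 := W.zero_mem
  have hL0 := L.zero_mem
  have dec : ∀ a, a = 0 → ¬ IsNonsquareImage σ a ∧ a ∈ W := by
    rintro a rfl
    exact ⟨hns0, hW0⟩
  have decL : ∀ b, b = 0 → b ∈ L := by
    rintro b rfl
    exact hL0
  rw [tableMult_eq hem hsm rfl rfl rfl rfl]
  fin_cases j
  · rw [key _ (fun a => a = 0) (fun b => b = 0), solCount_eq_one]
    · simp
    · intro a b
      have := dec a
      have := decL b
      rw [hrow]
      split_ifs <;> simp <;> tauto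
  · rw [key _ (fun a => a = 0) (fun b => b ∈ L ∧ ¬ b = 0), solCount_eq_one, cL0]
    · simp
    · intro a b
      have := dec a
      rw [hrow]
      split_ifs <;> simp <;> tauto
  · have h := solCount_add_not (fun _ : F × F => True) (fun x => x.1 ∈ W ∧ x.2 ∈ L)
    simp only [true_and, solCount_true, Fintype.card_prod] at h
    rw [solCount_prod_and (· ∈ W) (· ∈ L), cL, hcard] at h
    rw [solCount_congr (R := fun x : F × F => ¬ (x.1 ∈ W ∧ x.2 ∈ L)) ?_]
    · have h' := congrArg (fun z : ℕ => (z : ℚ)) h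
      push_cast at h'
      rw [cW] at h'
      change _ = (p : ℚ) ^ e * (p ^ e - p / p ^ (2 * s))
      linear_combination h'
    · rintro ⟨a, b⟩
      rw [hrow]
      split_ifs <;> simp <;> tauto
  · rw [key _ (fun a => (a ∈ W ∧ ¬ IsNonsquareImage σ a) ∧ ¬ a = 0) (fun b => b = 0)
      (fun a b => ?_), cG, solCount_eq_one]
    · simp
      field_simp
      ring
    · have := decL b
      rw [hrow]
      split_ifs <;> simp <;> tauto
  · rw [key _ (IsNonsquareImage σ) (fun b => b = 0) (fun a b => ?_), cB, solCount_eq_one]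
    · simp
      field_simp
      ring
    · have := decL b
      have := dec a
      have := hnsW a
      rw [hrow]
      split_ifs <;> simp <;> tauto
  · rw [key _ (fun a => (a ∈ W ∧ ¬ IsNonsquareImage σ a) ∧ ¬ a = 0) (fun b => b ∈ L ∧ ¬ b = 0)
      (fun a b => ?_), cG, cL0]
    · simp
      field_simp
      ring
    · rw [hrow]
      split_ifs <;> simp <;> tauto
  · rw [key _ (IsNonsquareImage σ) (fun b => b ∈ L ∧ ¬ b = 0) (fun a b => ?_), cB, cL0]
    · simp
      field_simp
      ring
    · have := dec a
      have := hnsW a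
      rw [hrow]
      split_ifs <;> simp <;> tauto

end Table

/-! ### Arithmetic of the parameters and of the table -/

theorem exists_parameters {e l m s : ℕ} (hl : 0 < l) (hs : s = Nat.gcd l e) (hem : e = 2 * m)
    (hes : Even (e / s)) (hms : Even (m / s)) :
    0 < s ∧ ∃ r k, l = s * r ∧ e = 4 * s * k ∧ m = 2 * s * k ∧ Odd r ∧ Nat.Coprime r k := by
  have hs0 : 0 < s := hs ▸ Nat.gcd_pos_of_pos_left _ hl
  obtain ⟨r, hr⟩ : s ∣ l := hs ▸ Nat.gcd_dvd_left l e
  obtain ⟨e', he'⟩ : s ∣ e := hs ▸ Nat.gcd_dvd_right l e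
  -- The quotient `m / s` is truncated division; evenness of `e / s` is what makes `s` divide `m`.
  have hm : m = s * (e' / 2) := by
    rw [he', Nat.mul_div_cancel_left _ hs0] at hes
    obtain ⟨j, rfl⟩ := hes
    rw [show (j + j) / 2 = j by omega]
    have : 2 * m = 2 * (s * j) := by rw [← hem, he']; ring
    omega
  rw [hm, Nat.mul_div_cancel_left _ hs0] at hms
  obtain ⟨k, hk⟩ := hms
  have hm' : m = 2 * s * k := by rw [hm, hk]; ring
  have he : e = 4 * s * k := by rw [hem, hm']; ring
  -- Dividing `gcd l e = s` by `s` gives coprimality to `4 * k`, hence both the oddness of `r` and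
  -- its coprimality to `k`.
  have hc : Nat.Coprime r (4 * k) := by
    have h : s * Nat.gcd r (4 * k) = s * 1 := by
      rw [← Nat.gcd_mul_left, ← hr, mul_one, show s * (4 * k) = e by rw [he]; ring, ← hs]
    exact Nat.eq_of_mul_eq_mul_left hs0 h
  refine ⟨hs0, r, k, hr, he, hm', ?_, hc.coprime_mul_left_right⟩
  exact Nat.coprime_two_right.1 (Nat.Coprime.coprime_dvd_right ⟨2 * k, by ring⟩ hc)

theorem tableWeight_pos (p : ℕ) (hp : p % 4 = 3) (e m s : ℕ) {j : Fin 7} (hj : j ≠ 0) :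
    0 < tableWeight p e m s j := by
  have h3 : (3 : ℚ) ≤ p := by
    have : 3 ≤ p := by omega
    exact_mod_cast this
  have h0 : (0 : ℚ) < p := by linarith
  have h1 : (0 : ℚ) < p - 1 := by linarith
  have h2 : (0 : ℚ) ≤ p - 3 := by linarith
  unfold tableWeight
  fin_cases j
  · exact absurd rfl hj
  all_goals
    simp
    positivity

theorem tableRow_eq_zero_iff {p : ℕ} [Fact p.Prime] {F : Type*} [Field F] [Algebra (ZMod p) F]
    (σ : F ≃ₐ[ZMod p] F) (x : F × F) : tableRow σ x = 0 ↔ x = 0 := by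
  obtain ⟨a, b⟩ := x
  constructor
  · intro h
    unfold tableRow at h
    split_ifs at h <;> simp_all
  · rintro h
    obtain ⟨rfl, rfl⟩ := Prod.mk_eq_zero.1 h
    simp [tableRow]

theorem tableWeight_one_eq_four (p : ℕ) {e m s : ℕ} (hem : e = 2 * m) (hms : m = s + 1)
    (hs : 0 < s) : tableWeight p e m s 1 = tableWeight p e m s 4 := by
  subst hms hem
  -- With `s = t + 1` no exponent truncates, and `2 e - 3` and `e + m + s - 2` coincide.
  obtain ⟨t, rfl⟩ : ∃ t, s = t + 1 := ⟨s - 1, by omega⟩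
  change ((p : ℚ) - 1) / 2 * ((p : ℚ) ^ _ + (p : ℚ) ^ _) =
    ((p : ℚ) - 1) ^ 2 / 2 * (p : ℚ) ^ _ + ((p : ℚ) - 1) * (p : ℚ) ^ _
  rw [show 2 * (2 * (t + 1 + 1)) - 2 = 4 * t + 6 by omega,
    show 2 * (2 * (t + 1 + 1)) - 3 = 4 * t + 5 by omega,
    show 2 * (t + 1 + 1) + (t + 1 + 1) + (t + 1) - 2 = 4 * t + 5 by omega]
  ring

/-! ### From classes of messages to the weight distribution -/

section Weights

variable {ι K X : Type*} [Fintype ι] [Field K] [DecidableEq K] [AddCommGroup X] [Module K X]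
  [Fintype X]

theorem weightCount_range {ι K X : Type*} [Fintype ι] [Field K] [DecidableEq K] [AddCommGroup X]
    [Module K X] (φ : X →ₗ[K] ι → K) (hφ : Function.Injective φ) (w : ℕ) :
    weightCount (LinearMap.range φ) w = solCount fun x => hammingNorm (φ x) = w := by
  change _ = Nat.card ({x | hammingNorm (φ x) = w} : Set X)
  rw [weightCount, ← Nat.card_image_of_injective hφ {x | hammingNorm (φ x) = w},
    Nat.card_coe_set_eq]
  congr 1
  ext c
  constructor
  · rintro ⟨⟨x, rfl⟩, h⟩
    exact ⟨x, h, rfl⟩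
  · rintro ⟨x, h, rfl⟩
    exact ⟨⟨x, rfl⟩, h⟩

/-- If the weight of `φ x` is a function of the class `row x`, the number of words of weight `w` is
obtained by adding up the sizes of the classes with that weight. -/
theorem weightCount_range_eq_sum {J : Type*} [Fintype J] (φ : X →ₗ[K] ι → K)
    (hφ : Function.Injective φ) (row : X → J) (W M : J → ℚ)
    (hW : ∀ x, (hammingNorm (φ x) : ℚ) = W (row x))
    (hM : ∀ j, (solCount (fun x => row x = j) : ℚ) = M j) (w : ℕ) :
    (weightCount (LinearMap.range φ) w : ℚ) = ∑ j, if W j = w then M j else 0 := by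
  rw [weightCount_range φ hφ, solCount_fiberwise _ row, Nat.cast_sum]
  refine Finset.sum_congr rfl fun j _ => ?_
  split_ifs with h
  · rw [← hM]
    refine congrArg _ (solCount_congr fun x => ⟨fun h => h.2, fun hx => ⟨?_, hx⟩⟩)
    have := hW x
    rw [hx, h] at this
    exact_mod_cast this
  · rw [solCount_false, Nat.cast_zero]
    rintro x ⟨rfl, rfl⟩
    exact h (hW x).symm

theorem numWeights_range_le {J : Type*} [DecidableEq J] (φ : X →ₗ[K] ι → K)
    (hφ : Function.Injective φ) (row : X → J) (W : J → ℚ)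
    (hW : ∀ x, (hammingNorm (φ x) : ℚ) = W (row x)) (S : Finset J)
    (hS : ∀ x, W (row x) ≠ 0 → ∃ j ∈ S, W j = W (row x)) :
    numWeights (LinearMap.range φ) ≤ S.card := by
  rw [numWeights]
  refine le_trans ?_ (Finset.card_image_le (s := S) (f := W))
  refine Finset.card_le_card_of_injOn (fun w : ℕ => (w : ℚ)) ?_ Nat.cast_injective.injOn
  intro w hw
  obtain ⟨hw1, hw2⟩ := Finset.mem_filter.1 hw
  rw [weightCount_range φ hφ] at hw2
  obtain ⟨x, rfl⟩ : ∃ x, hammingNorm (φ x) = w := by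
    by_contra! h
    exact hw2 (solCount_false h)
  have h0 : W (row x) ≠ 0 := by
    rw [← hW]
    have := (Finset.mem_Icc.1 hw1).1
    exact_mod_cast (by omega : hammingNorm (φ x) ≠ 0)
  obtain ⟨j, hj, hj2⟩ := hS x h0
  exact Finset.mem_coe.2 (Finset.mem_image.2 ⟨j, hj, hj2.trans (hW x).symm⟩)

end Weights

end WeightDist

/-! ### The main theorem -/

theorem theorem2 (p : ℕ) [Fact p.Prime] (hp : p % 4 = 3)
    (F : Type*) [Field F] [Fintype F] [Algebra (ZMod p) F]
    (e l m s : ℕ) (hcard : Fintype.card F = p ^ e) (hl : 0 < l)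
    (hs : s = Nat.gcd l e) (hem : e = 2 * m)
    (hes : Even (e / s)) (hms : s + 1 ≤ m) (hms2 : Even (m / s)) (i : Fin 2) :
    -- the length
    ((WeightDist.definingSet p F l i).card : ℚ) =
        ((p : ℚ) - 1) / 2 * ((p : ℚ) ^ (2 * e - 2) + (p : ℚ) ^ (e + m + s - 2)) ∧
    -- the dimension
    Module.finrank (ZMod p) (WeightDist.code p F (WeightDist.definingSet p F l i)) = 2 * e ∧
    -- the weight distribution; rows of the table with equal weights are added up
    (∀ w : ℕ,
      (WeightDist.weightCount (WeightDist.code p F (WeightDist.definingSet p F l i)) w : ℚ) =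
        ∑ j : Fin 7, if WeightDist.tableWeight p e m s j = (w : ℚ)
          then WeightDist.tableMult p e m s j else 0) ∧
    -- at most six nonzero weights
    WeightDist.numWeights (WeightDist.code p F (WeightDist.definingSet p F l i)) ≤ 6 ∧
    -- when `m = s + 1` two rows have the same weight, and there are at most five nonzero weights
    (m = s + 1 →
      ((p : ℚ) - 1) / 2 * ((p : ℚ) ^ (2 * e - 2) + (p : ℚ) ^ (e + m + s - 2)) =
        ((p : ℚ) - 1) ^ 2 / 2 * (p : ℚ) ^ (2 * e - 3)
          + ((p : ℚ) - 1) * (p : ℚ) ^ (e + m + s - 2) ∧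
      WeightDist.numWeights (WeightDist.code p F (WeightDist.definingSet p F l i)) ≤ 5) := by
  open WeightDist in
  obtain ⟨hs0, r, k, hlr, he, hm, hr, hc⟩ := exists_parameters hl hs hem hes hms2
  have hodd : Odd p := Nat.odd_iff.2 (by omega)
  have hσ : ∀ x, frobeniusPow p F l x = x ^ p ^ (s * r) := fun x => by
    rw [frobeniusPow_apply, hlr]
  have hcard' : Fintype.card F = p ^ (4 * s * k) := by rw [hcard, he]
  have hN : ∀ v ≠ 0, (solCount fun x => twistedTraceForm (frobeniusPow p F l) x = v) =
      solCount fun x => twistedTraceForm (frobeniusPow p F l) x = 1 := fun v hv =>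
    solCount_twistedTraceForm_eq (ZMod.card p) hσ hcard' hr hv
  have hPN := card_mul_solCount_twistedTraceForm (ZMod.card p) hodd hs0 hσ hcard' hr hc
  rw [← he, ← hm] at hPN
  have hR := radCard_twistedTraceForm hodd (Fact.out : p.Prime).one_lt hs0 hσ hcard' hr hc
  obtain ⟨hlen, hwt⟩ := card_weight_eq_tableWeight (frobeniusPow p F l) hp hcard hem hs0 hms hN
    hPN i
  have hM := solCount_tableRow (frobeniusPow p F l) hp hcard hem hms hN hPN hR
  set φ := codewordMap p F (definingSet p F l i) with hφdef
  have hW : ∀ x, (hammingNorm (φ x) : ℚ) =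
      tableWeight p e m s (tableRow (frobeniusPow p F l) x) := by
    rintro ⟨a, b⟩
    rw [← hwt, ← card_definingSet, ← hammingNorm_codewordMap_add p l i a b, Nat.cast_add,
      add_sub_cancel_right]
  -- Row `0` contains only the zero pair and every other row has positive weight, so the kernel is
  -- trivial.
  have hφ : Function.Injective φ := by
    rw [injective_iff_map_eq_zero]
    intro x hx
    rw [← tableRow_eq_zero_iff (frobeniusPow p F l)]
    by_contra hne
    have := tableWeight_pos p hp e m s hne
    rw [← hW, hx] at this
    simp at this
  have hrow : ∀ x, tableWeight p e m s (tableRow (frobeniusPow p F l) x) ≠ 0 →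
      tableRow (frobeniusPow p F l) x ≠ 0 := by
    intro x hx h
    rw [h] at hx
    exact hx rfl
  refine ⟨?_, ?_, ?_, ?_, fun h => ⟨tableWeight_one_eq_four p hem h hs0, ?_⟩⟩
  · rw [card_definingSet, hlen]
    rfl
  · rw [code, LinearMap.finrank_range_of_inj hφ, Module.finrank_prod, ← two_mul]
    have h := Module.card_eq_pow_finrank (K := ZMod p) (V := F)
    rw [ZMod.card, hcard] at h
    rw [Nat.pow_right_injective (Fact.out : p.Prime).two_le h]
  · exact weightCount_range_eq_sum φ hφ _ _ _ hW hM
  · exact numWeights_range_le φ hφ _ _ hW (Finset.univ.erase 0) fun x hx =>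
      ⟨_, Finset.mem_erase.2 ⟨hrow x hx, Finset.mem_univ _⟩, rfl⟩
  -- Row `1` can be dropped because row `4` has the same weight when `m = s + 1`.
  · refine numWeights_range_le φ hφ _ _ hW ((Finset.univ.erase 0).erase 1) fun x hx => ?_
    by_cases h1 : tableRow (frobeniusPow p F l) x = 1
    · exact ⟨4, by decide, by rw [h1, tableWeight_one_eq_four p hem h hs0]⟩
    · exact ⟨_, Finset.mem_erase.2 ⟨h1, Finset.mem_erase.2 ⟨hrow x hx, Finset.mem_univ _⟩⟩, rfl⟩
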